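/- Let $\mathcal A$ be a Grothendieck category with enough projectives. Let $\mathsf C$ and $\mathsf D$ be full additive subcategories of $\mathcal A$ that are closed under isomorphisms and direct summands. Assume that $\mathsf C$ is special preenveloping: every object $N$ has an exact sequence $0\to N\to I\to \Sigma N\to 0$ with $I\in\mathsf C$ and $\mathrm{Ext}^1(\Sigma N,C)=0$ for all $C\in\mathsf C$. Dually, assume that $\mathsf D$ is special precovering: every object $M$ has an exact sequence $0\to\Omega M\to P\to M\to 0$ with $P\in\mathsf D$ and $\mathrm{Ext}^1(D,\Omega M)=0$ for all $D\in\mathsf D$. Fix one such sequence for each object, and let $\Sigma^i N$ and $\Omega^i M$ be the iterated cosyzygies and syzygies, with $\Sigma^0N=N$ and $\Omega^0M=M$. Complete cohomology. Let $\underline{\mathrm{Hom}}^{\mathsf C}(M,N)$ be the quotient of $\mathrm{Hom}(M,N)$ by the subgroup of morphisms that factor through an object of $\mathsf C$, and similarly for $\mathsf D$. The assignment $\Sigma$ induces maps $\underline{\mathrm{Hom}}^{\mathsf C}(M,N)\to\underline{\mathrm{Hom}}^{\mathsf C}(\Sigma M,\Sigma N)$, and $\Omega$ induces maps $\underline{\mathrm{Hom}}^{\mathsf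 D}(M,N)\to\underline{\mathrm{Hom}}^{\mathsf D}(\Omega M,\Omega N)$. For $n\in\mathbb Z$ put $$\widetilde{\mathrm{Ext}}{}^{\,n}_{\mathsf C}(M,N)=\operatorname{colim}_i\underline{\mathrm{Hom}}^{\mathsf C}(\Sigma^iM,\Sigma^{i+n}N),\qquad \widetilde{\mathrm{Ext}}{}^{\,n}_{\mathsf D}(M,N)=\operatorname{colim}_i\underline{\mathrm{Hom}}^{\mathsf D}(\Omega^{i+n}M,\Omega^iN),$$ the colimits being over all $i\ge\max(0,-n)$. Both are functors $\mathcal A^{\mathrm{op}}\times\mathcal A\to\mathsf{Ab}$. Dimensions. A proper $\mathsf C$-coresolution of $N$ is an exact sequence $0\to N\to I^0\to I^1\to\cdots$ with all $I^k\in\mathsf C$ that stays exact under $\mathrm{Hom}(-,C)$ for every $C\in\mathsf C$; the $\mathsf C$-injective dimension of $N$ is $\inf_I\sup\{k\mid I^k\neq0\}$ over all of them. Proper $\mathsf D$-resolutions (exact sequences $\cdots\to P_1\to P_0\to M\to0$ with all $P_k\in\mathsf D$ that stay exact under $\mathrm{Hom}(D,-)$ for every $D\in\mathsf D$) and the $\mathsf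 D$-projective dimension are defined dually. Assume that $(\mathsf D,\mathsf C)$ is a balanced pair: $\mathsf D$ is precovering, $\mathsf C$ is preenveloping, every object has a proper $\mathsf D$-resolution that stays exact under $\mathrm{Hom}(-,C)$ for all $C\in\mathsf C$, and every object has a proper $\mathsf C$-coresolution that stays exact under $\mathrm{Hom}(D,-)$ for all $D\in\mathsf D$. Assume that $\mathsf D$ is resolving (it contains all projectives and, for each short exact sequence $0\to X'\to X\to X''\to0$ with $X''\in\mathsf D$, one has $X\in\mathsf D$ if and only if $X'\in\mathsf D$) and that $\mathsf C$ is coresolving (it contains all injectives and, for each such sequence with $X'\in\mathsf C$, one has $X\in\mathsf C$ if and only if $X''\in\mathsf C$). Then the following are equivalent: (i) every object of $\mathsf C$ has finite $\mathsf D$-projective dimension and every object of $\mathsf D$ has finite $\mathsf C$-injective dimension; (ii) for each $n\in\mathbb Z$ there is an isomorphism $\widetilde{\mathrm{Ext}}{}^{\,n}_{\mathsf C}(M,N)\cong\widetilde{\mathrm{Ext}}{}^{\,n}_{\mathsf D}(M,N)$, natural in $M,N\in\mathcal A$; (iii) for every object $M$ in $\mathsf C$ or in $\mathsf D$ there is an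 isomorphism of abelian groups $\widetilde{\mathrm{Ext}}{}^{\,0}_{\mathsf C}(M,M)\cong\widetilde{\mathrm{Ext}}{}^{\,0}_{\mathsf D}(M,M)$. -/

import Mathlib

open CategoryTheory Limits Opposite

universe w v u

noncomputable section

namespace RelativeCohomology

variable {A : Type u} [Category.{v} A] [Abelian A]

/-! ### Proper (co)resolutions and relative dimensions -/

/-- An exact sequence `0 → N → I⁰ → I¹ → ⋯`. -/
structure Coresolution (N : A) where
  /-- The complex `I⁰ → I¹ → ⋯`. -/
  cocomplex : CochainComplex A ℕ
  /-- The augmentation. -/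
  ι : N ⟶ cocomplex.X 0
  ι_d : ι ≫ cocomplex.d 0 1 = 0
  mono : Mono ι
  exact_zero : (ShortComplex.mk ι (cocomplex.d 0 1) ι_d).Exact
  exact_succ : ∀ n : ℕ, (ShortComplex.mk (cocomplex.d n (n + 1))
    (cocomplex.d (n + 1) (n + 2)) (cocomplex.d_comp_d _ _ _)).Exact

/-- An exact sequence `⋯ → P₁ → P₀ → M → 0`. -/
structure Resolution (M : A) where
  /-- The complex `⋯ → P₁ → P₀`. -/
  complex : ChainComplex A ℕ
  /-- The augmentation. -/
  π : complex.X 0 ⟶ M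
  d_π : complex.d 1 0 ≫ π = 0
  epi : Epi π
  exact_zero : (ShortComplex.mk (complex.d 1 0) π d_π).Exact
  exact_succ : ∀ n : ℕ, (ShortComplex.mk (complex.d (n + 2) (n + 1))
    (complex.d (n + 1) n) (complex.d_comp_d _ _ _)).Exact

/-- The sequence `⋯ → Hom(I¹, X) → Hom(I⁰, X) → Hom(N, X) → 0` is exact. -/
structure Coresolution.HomToExact {N : A} (I : Coresolution N) (X : A) : Prop where
  surjective : Function.Surjective (fun f : I.cocomplex.X 0 ⟶ X ↦ I.ι ≫ f)
  exact_zero : Function.Exact (fun f : I.cocomplex.X 1 ⟶ X ↦ I.cocomplex.d 0 1 ≫ f)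
    (fun f : I.cocomplex.X 0 ⟶ X ↦ I.ι ≫ f)
  exact_succ : ∀ n : ℕ,
    Function.Exact (fun f : I.cocomplex.X (n + 2) ⟶ X ↦ I.cocomplex.d (n + 1) (n + 2) ≫ f)
      (fun f : I.cocomplex.X (n + 1) ⟶ X ↦ I.cocomplex.d n (n + 1) ≫ f)

/-- The sequence `0 → Hom(X, N) → Hom(X, I⁰) → Hom(X, I¹) → ⋯` is exact. -/
structure Coresolution.HomFromExact {N : A} (I : Coresolution N) (X : A) : Prop where
  injective : Function.Injective (fun f : X ⟶ N ↦ f ≫ I.ι)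
  exact_zero : Function.Exact (fun f : X ⟶ N ↦ f ≫ I.ι)
    (fun f : X ⟶ I.cocomplex.X 0 ↦ f ≫ I.cocomplex.d 0 1)
  exact_succ : ∀ n : ℕ,
    Function.Exact (fun f : X ⟶ I.cocomplex.X n ↦ f ≫ I.cocomplex.d n (n + 1))
      (fun f : X ⟶ I.cocomplex.X (n + 1) ↦ f ≫ I.cocomplex.d (n + 1) (n + 2))

/-- The sequence `⋯ → Hom(X, P₁) → Hom(X, P₀) → Hom(X, M) → 0` is exact. -/
structure Resolution.HomFromExact {M : A} (P : Resolution M) (X : A) : Prop where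
  surjective : Function.Surjective (fun f : X ⟶ P.complex.X 0 ↦ f ≫ P.π)
  exact_zero : Function.Exact (fun f : X ⟶ P.complex.X 1 ↦ f ≫ P.complex.d 1 0)
    (fun f : X ⟶ P.complex.X 0 ↦ f ≫ P.π)
  exact_succ : ∀ n : ℕ,
    Function.Exact (fun f : X ⟶ P.complex.X (n + 2) ↦ f ≫ P.complex.d (n + 2) (n + 1))
      (fun f : X ⟶ P.complex.X (n + 1) ↦ f ≫ P.complex.d (n + 1) n)

/-- The sequence `0 → Hom(M, X) → Hom(P₀, X) → Hom(P₁, X) → ⋯` is exact. -/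
structure Resolution.HomToExact {M : A} (P : Resolution M) (X : A) : Prop where
  injective : Function.Injective (fun f : M ⟶ X ↦ P.π ≫ f)
  exact_zero : Function.Exact (fun f : M ⟶ X ↦ P.π ≫ f)
    (fun f : P.complex.X 0 ⟶ X ↦ P.complex.d 1 0 ≫ f)
  exact_succ : ∀ n : ℕ,
    Function.Exact (fun f : P.complex.X n ⟶ X ↦ P.complex.d (n + 1) n ≫ f)
      (fun f : P.complex.X (n + 1) ⟶ X ↦ P.complex.d (n + 2) (n + 1) ≫ f)

/-- A proper `Y`-coresolution of `N`: all terms lie in `Y`, and the augmented sequence is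
`Hom(-, Y)`-exact. -/
structure ProperCoresolution (Y : ObjectProperty A) (N : A) extends Coresolution N where
  mem : ∀ n : ℕ, Y (cocomplex.X n)
  proper : ∀ X : A, Y X → toCoresolution.HomToExact X

/-- A proper `X`-resolution of `M`: all terms lie in `X`, and the augmented sequence is
`Hom(X, -)`-exact. -/
structure ProperResolution (X : ObjectProperty A) (M : A) extends Resolution M where
  mem : ∀ n : ℕ, X (complex.X n)
  proper : ∀ Z : A, X Z → toResolution.HomFromExact Z

/-- The relative injective dimension `Y-id N = inf {sup I | N → I a proper Y-coresolution}`,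
where `sup I = sup {n | Iⁿ ≠ 0}` (it is `⊥`, that is `-∞`, for `I = 0`; the infimum is `⊤`, that
is `∞`, if there is no proper coresolution). -/
def relInjDim (Y : ObjectProperty A) (N : A) : WithBot ℕ∞ :=
  ⨅ I : ProperCoresolution Y N, ⨆ (n : ℕ) (_ : ¬ IsZero (I.cocomplex.X n)), (n : WithBot ℕ∞)

/-- The relative projective dimension `X-pd M = inf {sup P | P → M a proper X-resolution}`. -/
def relProjDim (X : ObjectProperty A) (M : A) : WithBot ℕ∞ :=
  ⨅ P : ProperResolution X M, ⨆ (n : ℕ) (_ : ¬ IsZero (P.complex.X n)), (n : WithBot ℕ∞)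

/-! ### Classes of subcategories -/

/-- Every object `M` has an `X`-precover: a morphism `X₀ → M` with `X₀` in `X` through which every
morphism from an object of `X` to `M` factors. -/
def IsPrecovering (X : ObjectProperty A) : Prop :=
  ∀ M : A, ∃ (X₀ : A) (p : X₀ ⟶ M), X X₀ ∧ ∀ (Z : A), X Z → ∀ f : Z ⟶ M, ∃ g : Z ⟶ X₀, g ≫ p = f

/-- Every object `N` has a `Y`-preenvelope: a morphism `N → Y₀` with `Y₀` in `Y` through which
every morphism from `N` to an object of `Y` factors. -/
def IsPreenveloping (Y : ObjectProperty A) : Prop :=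
  ∀ N : A, ∃ (Y₀ : A) (i : N ⟶ Y₀), Y Y₀ ∧ ∀ (Z : A), Y Z → ∀ f : N ⟶ Z, ∃ g : Y₀ ⟶ Z, i ≫ g = f

/-- Balanced pairs `(X, Y)` of subcategories. -/
structure IsBalancedPair (X Y : ObjectProperty A) : Prop where
  precovering : IsPrecovering X
  preenveloping : IsPreenveloping Y
  exists_resolution : ∀ M : A, ∃ P : ProperResolution X M, ∀ Z : A, Y Z → P.HomToExact Z
  exists_coresolution : ∀ N : A, ∃ I : ProperCoresolution Y N, ∀ Z : A, X Z → I.HomFromExact Z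

/-- `Y` contains all injectives and, for each short exact sequence `0 → X₁ → X₂ → X₃ → 0` with
`X₁` in `Y`, one has `X₂` in `Y` if and only if `X₃` is in `Y`. -/
structure IsCoresolving (Y : ObjectProperty A) : Prop where
  injective : ∀ E : A, Injective E → Y E
  mem_iff : ∀ S : ShortComplex A, S.ShortExact → Y S.X₁ → (Y S.X₂ ↔ Y S.X₃)

/-- `X` contains all projectives and, for each short exact sequence `0 → X₁ → X₂ → X₃ → 0` with
`X₃` in `X`, one has `X₂` in `X` if and only if `X₁` is in `X`. -/
structure IsResolving (X : ObjectProperty A) : Prop where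
  projective : ∀ E : A, Projective E → X E
  mem_iff : ∀ S : ShortComplex A, S.ShortExact → X S.X₃ → (X S.X₂ ↔ X S.X₁)

/-- The left orthogonal `{M | Ext¹(M, Z) = 0 for all Z in Y}`. -/
def leftPerp [HasExt.{w} A] (Y : ObjectProperty A) : ObjectProperty A :=
  fun M ↦ ∀ Z : A, Y Z → Subsingleton (Abelian.Ext.{w} M Z 1)

/-- The right orthogonal `{N | Ext¹(Z, N) = 0 for all Z in X}`. -/
def rightPerp [HasExt.{w} A] (X : ObjectProperty A) : ObjectProperty A :=
  fun N ↦ ∀ Z : A, X Z → Subsingleton (Abelian.Ext.{w} Z N 1)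

/-- A special `C`-preenvelope of `N`: an exact sequence `0 → N → I → ΣN → 0` with `I` in `C` and
`ΣN` in the left orthogonal of `C`. -/
structure SpecialPreenvelope [HasExt.{w} A] (C : ObjectProperty A) (N : A) where
  /-- The middle term. -/
  I : A
  /-- The cosyzygy. -/
  cosyz : A
  /-- The inclusion. -/
  ι : N ⟶ I
  /-- The projection. -/
  π : I ⟶ cosyz
  ι_π : ι ≫ π = 0
  shortExact : (ShortComplex.mk ι π ι_π).ShortExact
  mem : C I
  cosyz_mem : leftPerp.{w} C cosyz

/-- A special `D`-precover of `M`: an exact sequence `0 → ΩM → P → M → 0` with `P` in `D` and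
`ΩM` in the right orthogonal of `D`. -/
structure SpecialPrecover [HasExt.{w} A] (D : ObjectProperty A) (M : A) where
  /-- The middle term. -/
  P : A
  /-- The syzygy. -/
  syz : A
  /-- The inclusion. -/
  ι : syz ⟶ P
  /-- The projection. -/
  π : P ⟶ M
  ι_π : ι ≫ π = 0
  shortExact : (ShortComplex.mk ι π ι_π).ShortExact
  mem : D P
  syz_mem : rightPerp.{w} D syz

/-- A choice of a special `C`-preenvelope of every object; it exists if and only if `C` is special
preenveloping. Splicing the chosen sequences gives a special proper `C`-coresolution of each
object. -/
abbrev SpecialPreenvelopes [HasExt.{w} A] (C : ObjectProperty A) : Type (max u v) :=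
  ∀ N : A, SpecialPreenvelope.{w} C N

/-- A choice of a special `D`-precover of every object; it exists if and only if `D` is special
precovering. -/
abbrev SpecialPrecovers [HasExt.{w} A] (D : ObjectProperty A) : Type (max u v) :=
  ∀ M : A, SpecialPrecover.{w} D M

/-! ### The stable category: `Hom(M, N)` modulo morphisms factoring through an object of `P` -/

/-- The morphism `f` factors through an object of `P`. -/
def FactorsThrough (P : ObjectProperty A) {M N : A} (f : M ⟶ N) : Prop :=
  ∃ (X : A) (_ : P X) (g : M ⟶ X) (h : X ⟶ N), g ≫ h = f

/-- Two morphisms are identified if their difference factors through an object of `P`. -/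
def stableRel (P : ObjectProperty A) : HomRel A :=
  fun _ _ f g ↦ FactorsThrough P (f - g)

section

variable {P : ObjectProperty A}

lemma FactorsThrough.neg {M N : A} {f : M ⟶ N} (hf : FactorsThrough P f) :
    FactorsThrough P (-f) := by
  obtain ⟨X, hX, g, h, rfl⟩ := hf
  exact ⟨X, hX, -g, h, by simp⟩

set_option linter.unusedSectionVars false in
lemma FactorsThrough.comp_left {L M N : A} (e : L ⟶ M) {f : M ⟶ N} (hf : FactorsThrough P f) :
    FactorsThrough P (e ≫ f) := by
  obtain ⟨X, hX, g, h, rfl⟩ := hf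
  exact ⟨X, hX, e ≫ g, h, by simp⟩

set_option linter.unusedSectionVars false in
lemma FactorsThrough.comp_right {M N K : A} {f : M ⟶ N} (hf : FactorsThrough P f) (e : N ⟶ K) :
    FactorsThrough P (f ≫ e) := by
  obtain ⟨X, hX, g, h, rfl⟩ := hf
  exact ⟨X, hX, g, h ≫ e, by simp⟩

variable [P.IsClosedUnderFiniteProducts]

lemma FactorsThrough.zero (M N : A) : FactorsThrough P (0 : M ⟶ N) :=
  ⟨⊤_ A, P.prop_terminal, 0, 0, by simp⟩

lemma FactorsThrough.add {M N : A} {f f' : M ⟶ N} (hf : FactorsThrough P f)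
    (hf' : FactorsThrough P f') : FactorsThrough P (f + f') := by
  obtain ⟨X, hX, g, h, rfl⟩ := hf
  obtain ⟨X', hX', g', h', rfl⟩ := hf'
  exact ⟨X ⊞ X', P.prop_of_isLimit_binaryFan (BinaryBiproduct.isLimit X X') hX hX',
    biprod.lift g g', biprod.desc h h', by simp⟩

instance stableRel_congruence : Congruence (stableRel P) where
  comp_left e _ _ h := by
    have := FactorsThrough.comp_left e h
    rwa [Preadditive.comp_sub] at this
  comp_right e h := by
    have := FactorsThrough.comp_right h e
    rwa [Preadditive.sub_comp] at this
  equivalence :=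
    { refl := fun f ↦ by
        change FactorsThrough P (f - f)
        rw [sub_self]
        exact FactorsThrough.zero _ _
      symm := fun h ↦ by
        have := FactorsThrough.neg h
        rwa [neg_sub] at this
      trans := fun h h' ↦ by
        have := FactorsThrough.add h h'
        rwa [sub_add_sub_cancel] at this }

lemma stableRel_add ⦃X Y : A⦄ (f₁ f₂ g₁ g₂ : X ⟶ Y) (h : stableRel P f₁ f₂)
    (h' : stableRel P g₁ g₂) : stableRel P (f₁ + g₁) (f₂ + g₂) := by
  have := FactorsThrough.add h h'
  rwa [← add_sub_add_comm] at this

end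

/-- The category with the objects of `A` whose morphism groups are the stable groups
`Hom(M, N) / P Hom(M, N)`, where `P Hom(M, N)` is the subgroup of the morphisms that factor through
an object of `P`. -/
abbrev StableCategory (P : ObjectProperty A) : Type u := CategoryTheory.Quotient (stableRel P)

/-- The projection from `A` to the stable category. -/
abbrev stableFunctor (P : ObjectProperty A) : A ⥤ StableCategory P :=
  CategoryTheory.Quotient.functor (stableRel P)

section

variable (P : ObjectProperty A) [P.IsClosedUnderFiniteProducts]

instance : Preadditive (StableCategory P) :=
  CategoryTheory.Quotient.preadditive (stableRel P) stableRel_add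

instance : (stableFunctor P).Additive :=
  CategoryTheory.Quotient.functor_additive (stableRel P) stableRel_add

variable {P}

lemma stableFunctor_map_eq_iff {M N : A} (f g : M ⟶ N) :
    (stableFunctor P).map f = (stableFunctor P).map g ↔ FactorsThrough P (f - g) :=
  CategoryTheory.Quotient.functor_map_eq_iff _ f g

end

/-! ### The cosyzygy endofunctor of the stable category -/

section Cosyzygy

variable [HasExt.{w} A] {C : ObjectProperty A}

lemma SpecialPreenvelope.exists_extension {N : A} (E : SpecialPreenvelope.{w} C N) {Z : A}
    (hZ : C Z) (f : N ⟶ Z) : ∃ g : E.I ⟶ Z, E.ι ≫ g = f := by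
  have := E.cosyz_mem Z hZ
  obtain ⟨x, hx⟩ := Abelian.Ext.contravariant_sequence_exact₁ E.shortExact Z
    (Abelian.Ext.mk₀ f) (add_zero 1) (Subsingleton.elim _ _)
  obtain ⟨g, rfl⟩ := (Abelian.Ext.mk₀_bijective _ _).2 x
  rw [Abelian.Ext.mk₀_comp_mk₀] at hx
  exact ⟨g, (Abelian.Ext.mk₀_bijective _ _).1 hx⟩

/-- `b : ΣM ⟶ ΣN` is induced by `f : M ⟶ N`: the two are the outer components of a morphism of
short exact sequences. -/
def IsCosyzygyMap {M N : A} (E : SpecialPreenvelope.{w} C M) (F : SpecialPreenvelope.{w} C N)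
    (f : M ⟶ N) (b : E.cosyz ⟶ F.cosyz) : Prop :=
  ∃ a : E.I ⟶ F.I, E.ι ≫ a = f ≫ F.ι ∧ E.π ≫ b = a ≫ F.π

lemma exists_isCosyzygyMap {M N : A} (E : SpecialPreenvelope.{w} C M)
    (F : SpecialPreenvelope.{w} C N) (f : M ⟶ N) : ∃ b, IsCosyzygyMap E F f b := by
  obtain ⟨a, ha⟩ := E.exists_extension F.mem (f ≫ F.ι)
  have := E.shortExact.epi_g
  have h0 : E.ι ≫ a ≫ F.π = 0 := by rw [← Category.assoc, ha, Category.assoc, F.ι_π, comp_zero]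
  exact ⟨E.shortExact.exact.desc (a ≫ F.π) h0, a, ha, E.shortExact.exact.g_desc _ _⟩

lemma IsCosyzygyMap.factorsThrough {M N : A} {E : SpecialPreenvelope.{w} C M}
    {F : SpecialPreenvelope.{w} C N} {f : M ⟶ N} {b : E.cosyz ⟶ F.cosyz}
    (hb : IsCosyzygyMap E F f b) (hf : FactorsThrough C f) : FactorsThrough C b := by
  obtain ⟨a, ha, hab⟩ := hb
  obtain ⟨X, hX, g, h, rfl⟩ := hf
  obtain ⟨e, rfl⟩ := E.exists_extension hX g
  have := E.shortExact.epi_g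
  have h0 : E.ι ≫ (a - e ≫ h ≫ F.ι) = 0 := by
    rw [Preadditive.comp_sub, ha]; simp
  refine ⟨F.I, F.mem, E.shortExact.exact.desc _ h0, F.π, ?_⟩
  rw [← cancel_epi E.π, hab, ← Category.assoc]
  have h1 : E.π ≫ E.shortExact.exact.desc _ h0 = _ := E.shortExact.exact.g_desc _ _
  rw [h1]
  simp [F.ι_π]

lemma IsCosyzygyMap.sub {M N : A} {E : SpecialPreenvelope.{w} C M}
    {F : SpecialPreenvelope.{w} C N} {f f' : M ⟶ N} {b b' : E.cosyz ⟶ F.cosyz}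
    (hb : IsCosyzygyMap E F f b) (hb' : IsCosyzygyMap E F f' b') :
    IsCosyzygyMap E F (f - f') (b - b') := by
  obtain ⟨a, ha, hab⟩ := hb
  obtain ⟨a', ha', hab'⟩ := hb'
  exact ⟨a - a', by simp [ha, ha'], by simp [hab, hab']⟩

lemma IsCosyzygyMap.add {M N : A} {E : SpecialPreenvelope.{w} C M}
    {F : SpecialPreenvelope.{w} C N} {f f' : M ⟶ N} {b b' : E.cosyz ⟶ F.cosyz}
    (hb : IsCosyzygyMap E F f b) (hb' : IsCosyzygyMap E F f' b') :
    IsCosyzygyMap E F (f + f') (b + b') := by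
  obtain ⟨a, ha, hab⟩ := hb
  obtain ⟨a', ha', hab'⟩ := hb'
  exact ⟨a + a', by simp [ha, ha'], by simp [hab, hab']⟩

lemma IsCosyzygyMap.comp {L M N : A} {E : SpecialPreenvelope.{w} C L}
    {F : SpecialPreenvelope.{w} C M} {G : SpecialPreenvelope.{w} C N} {f : L ⟶ M} {g : M ⟶ N}
    {b : E.cosyz ⟶ F.cosyz} {c : F.cosyz ⟶ G.cosyz}
    (hb : IsCosyzygyMap E F f b) (hc : IsCosyzygyMap F G g c) :
    IsCosyzygyMap E G (f ≫ g) (b ≫ c) := by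
  obtain ⟨a, ha, hab⟩ := hb
  obtain ⟨a', ha', hab'⟩ := hc
  exact ⟨a ≫ a', by rw [← Category.assoc, ha, Category.assoc, ha', Category.assoc],
    by rw [← Category.assoc, hab, Category.assoc, hab', Category.assoc]⟩

lemma IsCosyzygyMap.id {M : A} (E : SpecialPreenvelope.{w} C M) :
    IsCosyzygyMap E E (𝟙 M) (𝟙 E.cosyz) :=
  ⟨𝟙 _, by simp, by simp⟩

variable [C.IsClosedUnderFiniteProducts]

lemma IsCosyzygyMap.map_eq {M N : A} {E : SpecialPreenvelope.{w} C M}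
    {F : SpecialPreenvelope.{w} C N} {f f' : M ⟶ N} {b b' : E.cosyz ⟶ F.cosyz}
    (hb : IsCosyzygyMap E F f b) (hb' : IsCosyzygyMap E F f' b')
    (h : FactorsThrough C (f - f')) : (stableFunctor C).map b = (stableFunctor C).map b' :=
  (stableFunctor_map_eq_iff _ _).2 ((hb.sub hb').factorsThrough h)

/-- The functor sending `M` to the cosyzygy `ΣM` and `f : M ⟶ N` to the class of any induced
morphism `ΣM ⟶ ΣN`. -/
def cosyzygyFunctorAux (S : SpecialPreenvelopes.{w} C) : A ⥤ StableCategory C where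
  obj M := (stableFunctor C).obj (S M).cosyz
  map {M N} f := (stableFunctor C).map (exists_isCosyzygyMap (S M) (S N) f).choose
  map_id M := by
    rw [← (stableFunctor C).map_id]
    refine IsCosyzygyMap.map_eq (exists_isCosyzygyMap (S M) (S M) (𝟙 M)).choose_spec
      (IsCosyzygyMap.id _) ?_
    rw [sub_self]; exact FactorsThrough.zero _ _
  map_comp {L M N} f g := by
    rw [← (stableFunctor C).map_comp]
    refine IsCosyzygyMap.map_eq (exists_isCosyzygyMap (S L) (S N) (f ≫ g)).choose_spec
      ((exists_isCosyzygyMap (S L) (S M) f).choose_spec.comp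
        (exists_isCosyzygyMap (S M) (S N) g).choose_spec) ?_
    rw [sub_self]; exact FactorsThrough.zero _ _

/-- The cosyzygy endofunctor `Σ` of the stable category. -/
def cosyzygyFunctor (S : SpecialPreenvelopes.{w} C) : StableCategory C ⥤ StableCategory C :=
  CategoryTheory.Quotient.lift (stableRel C) (cosyzygyFunctorAux S) fun M N f₁ f₂ h ↦
    IsCosyzygyMap.map_eq (exists_isCosyzygyMap (S M) (S N) f₁).choose_spec
      (exists_isCosyzygyMap (S M) (S N) f₂).choose_spec h

instance (S : SpecialPreenvelopes.{w} C) : (cosyzygyFunctor S).Additive where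
  map_add {M N f g} := by
    obtain ⟨f, rfl⟩ := (stableFunctor C).map_surjective (X := M.as) (Y := N.as) f
    obtain ⟨g, rfl⟩ := (stableFunctor C).map_surjective (X := M.as) (Y := N.as) g
    rw [← Functor.map_add]
    change (cosyzygyFunctorAux S).map (f + g) =
      (cosyzygyFunctorAux S).map f + (cosyzygyFunctorAux S).map g
    have hf := (exists_isCosyzygyMap (S M.as) (S N.as) f).choose_spec
    have hg := (exists_isCosyzygyMap (S M.as) (S N.as) g).choose_spec
    refine (IsCosyzygyMap.map_eq (exists_isCosyzygyMap (S M.as) (S N.as) (f + g)).choose_spec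
      (hf.add hg) ?_).trans (stableFunctor C).map_add
    rw [sub_self]; exact FactorsThrough.zero _ _

end Cosyzygy

/-! ### The syzygy endofunctor of the stable category -/

section Syzygy

variable [HasExt.{w} A] {D : ObjectProperty A}

lemma SpecialPrecover.exists_lifting {M : A} (E : SpecialPrecover.{w} D M) {Z : A}
    (hZ : D Z) (f : Z ⟶ M) : ∃ g : Z ⟶ E.P, g ≫ E.π = f := by
  have := E.syz_mem Z hZ
  obtain ⟨x, hx⟩ := Abelian.Ext.covariant_sequence_exact₃ Z E.shortExact
    (Abelian.Ext.mk₀ f) (zero_add 1) (Subsingleton.elim _ _)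
  obtain ⟨g, rfl⟩ := (Abelian.Ext.mk₀_bijective _ _).2 x
  rw [Abelian.Ext.mk₀_comp_mk₀] at hx
  exact ⟨g, (Abelian.Ext.mk₀_bijective _ _).1 hx⟩

/-- `b : ΩM ⟶ ΩN` is induced by `f : M ⟶ N`: the two are the outer components of a morphism of
short exact sequences. -/
def IsSyzygyMap {M N : A} (E : SpecialPrecover.{w} D M) (F : SpecialPrecover.{w} D N)
    (f : M ⟶ N) (b : E.syz ⟶ F.syz) : Prop :=
  ∃ a : E.P ⟶ F.P, a ≫ F.π = E.π ≫ f ∧ b ≫ F.ι = E.ι ≫ a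

lemma exists_isSyzygyMap {M N : A} (E : SpecialPrecover.{w} D M)
    (F : SpecialPrecover.{w} D N) (f : M ⟶ N) : ∃ b, IsSyzygyMap E F f b := by
  obtain ⟨a, ha⟩ := F.exists_lifting E.mem (E.π ≫ f)
  have := F.shortExact.mono_f
  have h0 : (E.ι ≫ a) ≫ F.π = 0 := by rw [Category.assoc, ha, ← Category.assoc, E.ι_π, zero_comp]
  exact ⟨F.shortExact.exact.lift (E.ι ≫ a) h0, a, ha, F.shortExact.exact.lift_f _ _⟩

lemma IsSyzygyMap.factorsThrough {M N : A} {E : SpecialPrecover.{w} D M}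
    {F : SpecialPrecover.{w} D N} {f : M ⟶ N} {b : E.syz ⟶ F.syz}
    (hb : IsSyzygyMap E F f b) (hf : FactorsThrough D f) : FactorsThrough D b := by
  obtain ⟨a, ha, hab⟩ := hb
  obtain ⟨X, hX, g, h, rfl⟩ := hf
  obtain ⟨e, rfl⟩ := F.exists_lifting hX h
  have := F.shortExact.mono_f
  have h0 : (a - (E.π ≫ g) ≫ e) ≫ F.π = 0 := by
    rw [Preadditive.sub_comp, ha]; simp
  refine ⟨E.P, E.mem, E.ι, F.shortExact.exact.lift _ h0, ?_⟩
  rw [← cancel_mono F.ι, hab, Category.assoc]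
  have h1 : F.shortExact.exact.lift _ h0 ≫ F.ι = _ := F.shortExact.exact.lift_f _ _
  rw [h1]
  simp [reassoc_of% E.ι_π]

lemma IsSyzygyMap.sub {M N : A} {E : SpecialPrecover.{w} D M}
    {F : SpecialPrecover.{w} D N} {f f' : M ⟶ N} {b b' : E.syz ⟶ F.syz}
    (hb : IsSyzygyMap E F f b) (hb' : IsSyzygyMap E F f' b') :
    IsSyzygyMap E F (f - f') (b - b') := by
  obtain ⟨a, ha, hab⟩ := hb
  obtain ⟨a', ha', hab'⟩ := hb'
  exact ⟨a - a', by simp [ha, ha'], by simp [hab, hab']⟩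

lemma IsSyzygyMap.add {M N : A} {E : SpecialPrecover.{w} D M}
    {F : SpecialPrecover.{w} D N} {f f' : M ⟶ N} {b b' : E.syz ⟶ F.syz}
    (hb : IsSyzygyMap E F f b) (hb' : IsSyzygyMap E F f' b') :
    IsSyzygyMap E F (f + f') (b + b') := by
  obtain ⟨a, ha, hab⟩ := hb
  obtain ⟨a', ha', hab'⟩ := hb'
  exact ⟨a + a', by simp [ha, ha'], by simp [hab, hab']⟩

lemma IsSyzygyMap.comp {L M N : A} {E : SpecialPrecover.{w} D L}
    {F : SpecialPrecover.{w} D M} {G : SpecialPrecover.{w} D N} {f : L ⟶ M} {g : M ⟶ N}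
    {b : E.syz ⟶ F.syz} {c : F.syz ⟶ G.syz}
    (hb : IsSyzygyMap E F f b) (hc : IsSyzygyMap F G g c) :
    IsSyzygyMap E G (f ≫ g) (b ≫ c) := by
  obtain ⟨a, ha, hab⟩ := hb
  obtain ⟨a', ha', hab'⟩ := hc
  exact ⟨a ≫ a', by rw [Category.assoc, ha', ← Category.assoc, ha, Category.assoc],
    by rw [Category.assoc, hab', ← Category.assoc, hab, Category.assoc]⟩

lemma IsSyzygyMap.id {M : A} (E : SpecialPrecover.{w} D M) :
    IsSyzygyMap E E (𝟙 M) (𝟙 E.syz) :=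
  ⟨𝟙 _, by simp, by simp⟩

variable [D.IsClosedUnderFiniteProducts]

lemma IsSyzygyMap.map_eq {M N : A} {E : SpecialPrecover.{w} D M}
    {F : SpecialPrecover.{w} D N} {f f' : M ⟶ N} {b b' : E.syz ⟶ F.syz}
    (hb : IsSyzygyMap E F f b) (hb' : IsSyzygyMap E F f' b')
    (h : FactorsThrough D (f - f')) : (stableFunctor D).map b = (stableFunctor D).map b' :=
  (stableFunctor_map_eq_iff _ _).2 ((hb.sub hb').factorsThrough h)

/-- The functor sending `M` to the syzygy `ΩM` and `f : M ⟶ N` to the class of any induced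
morphism `ΩM ⟶ ΩN`. -/
def syzygyFunctorAux (T : SpecialPrecovers.{w} D) : A ⥤ StableCategory D where
  obj M := (stableFunctor D).obj (T M).syz
  map {M N} f := (stableFunctor D).map (exists_isSyzygyMap (T M) (T N) f).choose
  map_id M := by
    rw [← (stableFunctor D).map_id]
    refine IsSyzygyMap.map_eq (exists_isSyzygyMap (T M) (T M) (𝟙 M)).choose_spec
      (IsSyzygyMap.id _) ?_
    rw [sub_self]; exact FactorsThrough.zero _ _
  map_comp {L M N} f g := by
    rw [← (stableFunctor D).map_comp]
    refine IsSyzygyMap.map_eq (exists_isSyzygyMap (T L) (T N) (f ≫ g)).choose_spec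
      ((exists_isSyzygyMap (T L) (T M) f).choose_spec.comp
        (exists_isSyzygyMap (T M) (T N) g).choose_spec) ?_
    rw [sub_self]; exact FactorsThrough.zero _ _

/-- The syzygy endofunctor `Ω` of the stable category. -/
def syzygyFunctor (T : SpecialPrecovers.{w} D) : StableCategory D ⥤ StableCategory D :=
  CategoryTheory.Quotient.lift (stableRel D) (syzygyFunctorAux T) fun M N f₁ f₂ h ↦
    IsSyzygyMap.map_eq (exists_isSyzygyMap (T M) (T N) f₁).choose_spec
      (exists_isSyzygyMap (T M) (T N) f₂).choose_spec h

instance (T : SpecialPrecovers.{w} D) : (syzygyFunctor T).Additive where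
  map_add {M N f g} := by
    obtain ⟨f, rfl⟩ := (stableFunctor D).map_surjective (X := M.as) (Y := N.as) f
    obtain ⟨g, rfl⟩ := (stableFunctor D).map_surjective (X := M.as) (Y := N.as) g
    rw [← Functor.map_add]
    change (syzygyFunctorAux T).map (f + g) =
      (syzygyFunctorAux T).map f + (syzygyFunctorAux T).map g
    have hf := (exists_isSyzygyMap (T M.as) (T N.as) f).choose_spec
    have hg := (exists_isSyzygyMap (T M.as) (T N.as) g).choose_spec
    refine (IsSyzygyMap.map_eq (exists_isSyzygyMap (T M.as) (T N.as) (f + g)).choose_spec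
      (hf.add hg) ?_).trans (stableFunctor D).map_add
    rw [sub_self]; exact FactorsThrough.zero _ _

end Syzygy

/-! ### Complete cohomology -/

section Stabilization

variable {P : ObjectProperty A} [P.IsClosedUnderFiniteProducts]

/-- `M ↦ Fᵏ M`, as a functor from `A` to the stable category. -/
def iterFunctor (F : StableCategory P ⥤ StableCategory P) : ℕ → (A ⥤ StableCategory P)
  | 0 => stableFunctor P
  | k + 1 => iterFunctor F k ⋙ F

/-- The bifunctor `(M, N) ↦ Hom(G M, H N)` with values in abelian groups. -/
def stableHom (G H : A ⥤ StableCategory P) : Aᵒᵖ ⥤ A ⥤ AddCommGrpCat.{v} :=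
  G.op ⋙ preadditiveCoyoneda ⋙ (Functor.whiskeringLeft _ _ _).obj H

/-- The action of `F` on morphisms, `Hom(G M, H N) → Hom(F (G M), F (H N))`. -/
def stableHomShift (F : StableCategory P ⥤ StableCategory P) [F.Additive]
    (G H : A ⥤ StableCategory P) : stableHom G H ⟶ stableHom (G ⋙ F) (H ⋙ F) where
  app M :=
    { app := fun N ↦ AddCommGrpCat.ofHom
        (F.mapAddHom : (G.obj M.unop ⟶ H.obj N) →+ (F.obj (G.obj M.unop) ⟶ F.obj (H.obj N)))
      naturality := fun N N' f ↦ by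
        ext x
        exact F.map_comp x (H.map f) }
  naturality M M' f := by
    ext N x
    exact F.map_comp (G.map f.unop) x

/-- The bifunctor `(M, N) ↦ colim_k Hom(F^(a+k) M, F^(b+k) N)`, with Hom-groups taken in the
stable category and transition morphisms given by the action of `F`. -/
def stabilizedHom (F : StableCategory P ⥤ StableCategory P) [F.Additive] (a b : ℕ) :
    Aᵒᵖ ⥤ A ⥤ AddCommGrpCat.{v} :=
  colimit (Functor.ofSequence
    (X := fun k : ℕ ↦ stableHom (iterFunctor F (a + k)) (iterFunctor F (b + k)))
    (fun k ↦ stableHomShift F (iterFunctor F (a + k)) (iterFunctor F (b + k))))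

end Stabilization

section Complete

variable [HasExt.{w} A]

/-- The `n`th complete cohomology with respect to `C`, as a bifunctor:
`(M, N) ↦ colim_i Hom(Σ^i M, Σ^(i+n) N)` (Hom modulo `C`), over all `i` with `i ≥ 0` and
`i + n ≥ 0`, indexed by `i = max(-n, 0) + k`, `i + n = max(n, 0) + k`. -/
def completeExtC {C : ObjectProperty A} [C.IsClosedUnderFiniteProducts]
    (S : SpecialPreenvelopes.{w} C) (n : ℤ) : Aᵒᵖ ⥤ A ⥤ AddCommGrpCat.{v} :=
  stabilizedHom (cosyzygyFunctor S) (-n).toNat n.toNat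

/-- The `n`th complete cohomology with respect to `D`, as a bifunctor:
`(M, N) ↦ colim_i Hom(Ω^(i+n) M, Ω^i N)` (Hom modulo `D`), over all `i` with `i ≥ 0` and
`i + n ≥ 0`, indexed by `i = max(-n, 0) + k`, `i + n = max(n, 0) + k`. -/
def completeExtD {D : ObjectProperty A} [D.IsClosedUnderFiniteProducts]
    (T : SpecialPrecovers.{w} D) (n : ℤ) : Aᵒᵖ ⥤ A ⥤ AddCommGrpCat.{v} :=
  stabilizedHom (syzygyFunctor T) n.toNat (-n).toNat

end Complete

end RelativeCohomology

end

/-! The whole proof takes place in the stable categories `A/C` with `Σ` and `A/D` with `Ω`. A proper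
short exact sequence can be rotated like a triangle. It follows that `M` has finite `C`-injective
dimension exactly when some `ΣᵏM` is zero in `A/C`, and finite `D`-projective dimension exactly when
some `ΩᵏM` is zero in `A/D` (`relInjDim_lt_top_iff`, `relProjDim_lt_top_iff`).

(i) ⇒ (ii). Let `W` be the class of objects killed by an iterate of `Σ` and by an iterate of `Ω`. By
(i), `W` contains `C` and `D`. Balancedness gives maps `M ⟶ ΣΩM` and `ΩΣN ⟶ N`, natural modulo `C`
and modulo `D` respectively. The first fits into a `C`-proper sequence `0 ⟶ P ⟶ M ⊞ I ⟶ ΣΩM ⟶ 0`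
with `P` in `D`, so an iterate of `Σ` inverts it (`isIso_endoPow_cosyzygyFunctor_map`); dually for
the second. Hence `W` is stable under `Σ` and `Ω`, and both act on `A/W`, where they invert the same
morphisms up to iteration. These morphisms have a calculus of left fractions, and in the
localization `Σ` and `Ω` become mutually inverse autoequivalences (`nonempty_mutualInversion`). Both
complete cohomologies are Hom-groups of this localization (`nonempty_stabilizedHom_iso_homBif`). A
morphism that dies there factors, after some iterations, through an object of `W`, and further
iterations kill it; a fraction becomes an honest morphism once its denominator has been inverted by
an iterate. Moving the autoequivalence from one argument to the other identifies the two
cohomologies.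

(iii) ⇒ (i). For `M` in `C` the group formed with `C` vanishes, hence so does the one formed with
`D`. The identity of `M` is then killed by an iterate of `Ω`, so `M` has finite `D`-projective
dimension. The case of `M` in `D` is dual. -/

noncomputable section

namespace RelativeCohomology

/-! ### Iterates of an endofunctor and the morphisms that some iterate inverts -/

section Iterates

variable {B : Type u} [Category.{v} B]

/-- The iterates of an endofunctor. -/
def endoPow (F : B ⥤ B) : ℕ → (B ⥤ B)
  | 0 => 𝟭 B
  | k + 1 => F ⋙ endoPow F k

lemma endoPow_succ' (F : B ⥤ B) (k : ℕ) : endoPow F (k + 1) = endoPow F k ⋙ F := by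
  induction k with
  | zero => rfl
  | succ k ih =>
    change F ⋙ endoPow F (k + 1) = (F ⋙ endoPow F k) ⋙ F
    rw [ih]; rfl

instance [Preadditive B] (F : B ⥤ B) [F.Additive] (k : ℕ) : (endoPow F k).Additive := by
  induction k with
  | zero => exact inferInstanceAs (𝟭 B).Additive
  | succ k ih => exact inferInstanceAs (F ⋙ endoPow F k).Additive

lemma endoPow_map_comp_obj {F : B ⥤ B} {k : ℕ} {X Y : B} {f : X ⟶ Y}
    (h : IsIso ((endoPow F k).map f)) : IsIso ((endoPow F (k + 1)).map f) := by
  -- An arbitrary `G` allows substitution along the equality of functors, where a rewrite under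
  -- `IsIso` would meet dependent types.
  have key : ∀ G : B ⥤ B, G = endoPow F k ⋙ F → IsIso (G.map f) := by
    rintro _ rfl
    exact inferInstanceAs (IsIso (F.map ((endoPow F k).map f)))
  exact key _ (endoPow_succ' F k)

lemma isIso_endoPow_map_of_le {F : B ⥤ B} {k l : ℕ} (hkl : k ≤ l) {X Y : B} {f : X ⟶ Y}
    (h : IsIso ((endoPow F k).map f)) : IsIso ((endoPow F l).map f) := by
  induction l, hkl using Nat.le_induction with
  | base => exact h
  | succ l _ ih => exact endoPow_map_comp_obj ih

/-- The morphisms inverted by some iterate of `F`. -/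
def evIso (F : B ⥤ B) : MorphismProperty B :=
  fun _ _ s ↦ ∃ k, IsIso ((endoPow F k).map s)

variable {F : B ⥤ B}

lemma evIso_of_isIso {X Y : B} (s : X ⟶ Y) [IsIso s] : evIso F s := ⟨0, by
  change IsIso s
  infer_instance⟩

lemma evIso.comp {X Y Z : B} {s : X ⟶ Y} {t : Y ⟶ Z} (hs : evIso F s) (ht : evIso F t) :
    evIso F (s ≫ t) := by
  obtain ⟨k, hk⟩ := hs
  obtain ⟨l, hl⟩ := ht
  have := isIso_endoPow_map_of_le (le_max_left k l) hk
  have := isIso_endoPow_map_of_le (le_max_right k l) hl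
  refine ⟨max k l, ?_⟩
  rw [Functor.map_comp]
  infer_instance

lemma evIso.of_comp {X Y Z : B} {s : X ⟶ Y} {t : Y ⟶ Z} (hs : evIso F s)
    (hst : evIso F (s ≫ t)) : evIso F t := by
  obtain ⟨k, hk⟩ := hs
  obtain ⟨l, hl⟩ := hst
  have := isIso_endoPow_map_of_le (le_max_left k l) hk
  have := isIso_endoPow_map_of_le (le_max_right k l) hl
  rw [Functor.map_comp] at this
  exact ⟨max k l, IsIso.of_isIso_comp_left ((endoPow F (max k l)).map s) _⟩

lemma evIso.map {X Y : B} {s : X ⟶ Y} (hs : evIso F s) : evIso F (F.map s) := by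
  obtain ⟨k, hk⟩ := hs
  exact ⟨k, endoPow_map_comp_obj hk⟩

instance : (evIso F).IsMultiplicative where
  id_mem _ := evIso_of_isIso _
  comp_mem _ _ := evIso.comp

/-- If `ε : GF → 1` is inverted objectwise by the iterates of `F`, then every morphism that is
inverted by an iterate of `G` is inverted by an iterate of `F`. -/
lemma evIso_le_of_counit {F G : B ⥤ B} (ε : G ⋙ F ⟶ 𝟭 B) (hε : ∀ X, evIso F (ε.app X)) :
    evIso G ≤ evIso F := by
  intro X Y s ⟨k, hk⟩
  induction k generalizing X Y with
  | zero => exact ⟨0, hk⟩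
  | succ k ih =>
    -- By induction `G.map s` is inverted by an iterate of `F`; the naturality square of `ε` and
    -- two-out-of-three pass this on to `s`.
    have h1 : evIso F (F.map (G.map s)) := (ih _ hk).map
    have h2 : F.map (G.map s) ≫ ε.app Y = ε.app X ≫ s := ε.naturality s
    exact (hε X).of_comp (h2 ▸ h1.comp (hε Y))

/-- If `η : 1 → FG` is inverted objectwise by the iterates of `G`, then every morphism that is
inverted by an iterate of `F` is inverted by an iterate of `G`. -/
lemma evIso_le_of_unit {F G : B ⥤ B} (η : 𝟭 B ⟶ F ⋙ G) (hη : ∀ X, evIso G (η.app X)) :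
    evIso F ≤ evIso G := by
  intro X Y s ⟨k, hk⟩
  induction k generalizing X Y with
  | zero => exact ⟨0, hk⟩
  | succ k ih =>
    have h1 : evIso G (G.map (F.map s)) := (ih _ hk).map
    have h2 : s ≫ η.app Y = η.app X ≫ G.map (F.map s) := η.naturality s
    -- The other half of two-out-of-three: `s ≫ η.app Y` and `η.app Y` are both inverted by a common
    -- iterate, hence so is `s`.
    obtain ⟨k, hk⟩ := hη Y
    obtain ⟨l, hl⟩ := (hη X).comp h1
    have := isIso_endoPow_map_of_le (le_max_left k l) hk
    have := isIso_endoPow_map_of_le (le_max_right k l) hl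
    rw [← h2, Functor.map_comp] at this
    exact ⟨max k l, IsIso.of_isIso_comp_right _ ((endoPow G (max k l)).map (η.app Y))⟩

/-- Induction on the number of iterates that invert the given denominator: a square completed after
applying `F` is carried back by `G` and composed with `η`. The new denominators are built from `η`
and images under `G`, so they are first seen to lie in `evIso G`; `hFG` moves them to `evIso F`. -/
lemma evIso_hasLeftCalculusOfFractions {F G : B ⥤ B} (η : 𝟭 B ⟶ F ⋙ G)
    (hη : ∀ X, evIso G (η.app X)) (hFG : evIso G ≤ evIso F) :
    (evIso F).HasLeftCalculusOfFractions := by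
  have hle : evIso F = evIso G := le_antisymm (evIso_le_of_unit η hη) hFG
  have nat {X Y : B} (f : X ⟶ Y) : f ≫ η.app Y = η.app X ≫ G.map (F.map f) := η.naturality f
  have ore (k : ℕ) : ∀ {X X' Y : B} (s : X ⟶ X') (f : X ⟶ Y), IsIso ((endoPow F k).map s) →
      ∃ (Y' : B) (t : Y ⟶ Y') (g : X' ⟶ Y'), evIso G t ∧ f ≫ t = s ≫ g := by
    induction k with
    | zero =>
      intro X X' Y s f hs
      have : IsIso s := hs
      exact ⟨Y, 𝟙 Y, inv s ≫ f, evIso_of_isIso _, by simp⟩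
    | succ k ih =>
      intro X X' Y s f hs
      obtain ⟨Z, t, g, ht, h⟩ := ih (F.map s) (F.map f) hs
      refine ⟨G.obj Z, η.app Y ≫ G.map t, η.app X' ≫ G.map g, (hη Y).comp ht.map, ?_⟩
      rw [← Category.assoc, nat f, Category.assoc, ← G.map_comp, h, G.map_comp,
        ← Category.assoc, ← nat s, Category.assoc]
  have ext (k : ℕ) : ∀ {X' X Y : B} (f₁ f₂ : X ⟶ Y) (s : X' ⟶ X),
      IsIso ((endoPow F k).map s) → s ≫ f₁ = s ≫ f₂ →
      ∃ (Y' : B) (t : Y ⟶ Y'), evIso G t ∧ f₁ ≫ t = f₂ ≫ t := by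
    induction k with
    | zero =>
      intro X' X Y f₁ f₂ s hs h
      have : IsIso s := hs
      exact ⟨Y, 𝟙 Y, evIso_of_isIso _, by rw [(cancel_epi s).1 h]⟩
    | succ k ih =>
      intro X' X Y f₁ f₂ s hs h
      obtain ⟨Z, t, ht, h'⟩ := ih (F.map f₁) (F.map f₂) (F.map s) hs
        (by rw [← F.map_comp, h, F.map_comp])
      refine ⟨G.obj Z, η.app Y ≫ G.map t, (hη Y).comp ht.map, ?_⟩
      rw [← Category.assoc, nat f₁, Category.assoc, ← G.map_comp, h', G.map_comp,
        ← Category.assoc, ← nat f₂, Category.assoc]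
  exact
    { exists_leftFraction := fun X Y φ ↦ by
        obtain ⟨k, hk⟩ := φ.hs
        obtain ⟨Y', t, g, ht, h⟩ := ore k φ.s φ.f hk
        exact ⟨⟨g, t, hFG _ ht⟩, h⟩
      ext := fun X' X Y f₁ f₂ s ⟨k, hk⟩ h ↦ by
        obtain ⟨Y', t, ht, h'⟩ := ext k f₁ f₂ s hk h
        exact ⟨Y', t, hFG _ ht, h'⟩ }

end Iterates

/-! ### Inverting an adjoint-like pair of endofunctors -/

/-- The localization must have morphisms in universe `v` for its Hom-groups to be comparable with
the colimits. Countably many denominators out of each `Y` suffice, so every Hom-set is a quotient of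
a countable union of Hom-sets of `B`. -/
lemma exists_locallySmall_localization {B : Type u} [Category.{v} B] (W : MorphismProperty B)
    [W.HasLeftCalculusOfFractions]
    (hW : ∀ Y : B, ∃ (Z : ℕ → B) (t : ∀ i, Y ⟶ Z i), (∀ i, W (t i)) ∧
      ∀ {Y' : B} (s : Y ⟶ Y'), W s → ∃ (i : ℕ) (g : Y' ⟶ Z i), s ≫ g = t i) :
    ∃ (B' : Type u) (_ : Category.{v} B') (L : B ⥤ B'), L.IsLocalization W := by
  have : LocallySmall.{v} W.Localization := ⟨fun X Y ↦ by
    obtain ⟨X, rfl⟩ := (Localization.Construction.objEquiv W).surjective X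
    obtain ⟨Y, rfl⟩ := (Localization.Construction.objEquiv W).surjective Y
    change Small.{v} (W.Q.obj X ⟶ W.Q.obj Y)
    obtain ⟨Z, t, ht, hZ⟩ := hW Y
    have (i : ℕ) : IsIso (W.Q.map (t i)) := Localization.inverts W.Q W _ (ht i)
    refine small_of_surjective
      (f := fun x : Σ i, (X ⟶ Z i) ↦ W.Q.map x.2 ≫ inv (W.Q.map (t x.1))) fun z ↦ ?_
    obtain ⟨φ, rfl⟩ := Localization.exists_leftFraction W.Q W z
    obtain ⟨i, g, h⟩ := hZ φ.s φ.hs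
    refine ⟨⟨i, φ.f ≫ g⟩, ?_⟩
    have : IsIso (W.Q.map φ.s) := Localization.inverts W.Q W _ φ.hs
    dsimp only
    rw [← cancel_mono (W.Q.map (t i)), Category.assoc, IsIso.inv_hom_id, Category.comp_id, ← h,
      W.Q.map_comp, W.Q.map_comp, MorphismProperty.LeftFraction.map_comp_map_s_assoc]⟩
  exact ⟨ShrinkHoms W.Localization, inferInstance, W.Q ⋙ ShrinkHoms.functor _, inferInstance⟩

/-- A category in which the endofunctors `F` and `G` of `B` become mutually inverse, together with
a description of its morphisms by fractions. -/
structure MutualInversion {B : Type u} [Category.{v} B] [Preadditive B] (F G : B ⥤ B) where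
  /-- The target category. -/
  carrier : Type u
  [category : Category.{v} carrier]
  [preadditive : Preadditive carrier]
  /-- The localization functor. -/
  functor : B ⥤ carrier
  [additive : functor.Additive]
  /-- The autoequivalence induced by `F` and `G`. -/
  equivalence : carrier ≌ carrier
  [functor_additive : equivalence.functor.Additive]
  [inverse_additive : equivalence.inverse.Additive]
  /-- The autoequivalence extends `F`. -/
  functorIso : F ⋙ functor ≅ functor ⋙ equivalence.functor
  /-- The inverse of the autoequivalence extends `G`. -/
  inverseIso : G ⋙ functor ≅ functor ⋙ equivalence.inverse
  isIso_map : ∀ {X Y : B} (s : X ⟶ Y), evIso F s → evIso G s → IsIso (functor.map s)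
  exists_fraction : ∀ {X Y : B} (z : functor.obj X ⟶ functor.obj Y),
    ∃ (Y' : B) (f : X ⟶ Y') (s : Y ⟶ Y'), evIso F s ∧ evIso G s ∧
      z ≫ functor.map s = functor.map f
  exists_comp_eq_zero : ∀ {X Y : B} (f : X ⟶ Y), functor.map f = 0 →
    ∃ (Y' : B) (s : Y ⟶ Y'), evIso F s ∧ evIso G s ∧ f ≫ s = 0

attribute [instance] MutualInversion.category MutualInversion.preadditive
  MutualInversion.additive MutualInversion.functor_additive MutualInversion.inverse_additive

/-- The `i`-th denominator is the iterated unit `Y ⟶ GⁱFⁱY`. If `Fⁱ` inverts `s`, then `Gⁱ` applied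
to the inverse of `Fⁱ s` shows that `s` divides it. -/
lemma exists_evIso_cofinal {B : Type u} [Category.{v} B] {F G : B ⥤ B} (η : 𝟭 B ⟶ F ⋙ G)
    (hη : ∀ X, evIso G (η.app X)) (Y : B) :
    ∃ (Z : ℕ → B) (t : ∀ i, Y ⟶ Z i), (∀ i, evIso G (t i)) ∧
      ∀ {Y' : B} (s : Y ⟶ Y'), evIso F s → ∃ (i : ℕ) (g : Y' ⟶ Z i), s ≫ g = t i := by
  have key (k : ℕ) : ∀ Y : B, ∃ (Z : B) (t : Y ⟶ Z), evIso G t ∧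
      ∀ {Y' : B} (s : Y ⟶ Y'), IsIso ((endoPow F k).map s) → ∃ g : Y' ⟶ Z, s ≫ g = t := by
    induction k with
    | zero =>
      refine fun Y ↦ ⟨Y, 𝟙 Y, evIso_of_isIso _, fun s hs ↦ ?_⟩
      have : IsIso s := hs
      exact ⟨inv s, by simp⟩
    | succ k ih =>
      intro Y
      obtain ⟨Z, t, ht, h⟩ := ih (F.obj Y)
      refine ⟨G.obj Z, η.app Y ≫ G.map t, (hη Y).comp ht.map, fun {Y'} s hs ↦ ?_⟩
      obtain ⟨g, hg⟩ := h (F.map s) hs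
      refine ⟨η.app Y' ≫ G.map g, ?_⟩
      have nat : s ≫ η.app Y' = η.app Y ≫ G.map (F.map s) := η.naturality s
      rw [← Category.assoc, nat, Category.assoc, ← G.map_comp, hg]
  choose Z t ht h using fun k ↦ key k Y
  exact ⟨Z, t, ht, fun s ⟨k, hk⟩ ↦ ⟨k, h k s hk⟩⟩

/-- The unit and the counit force `evIso F = evIso G`. Both functors preserve this class and so
descend to the localization, where `η` and `ε` become isomorphisms. No triangle identity is needed.
-/
theorem nonempty_mutualInversion {B : Type u} [Category.{v} B] [Preadditive B] {F G : B ⥤ B}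
    [F.Additive] [G.Additive] (η : 𝟭 B ⟶ G ⋙ F) (ε : F ⋙ G ⟶ 𝟭 B)
    (hη : ∀ X, evIso F (η.app X)) (hε : ∀ X, evIso G (ε.app X)) :
    Nonempty (MutualInversion F G) := by
  have hFG : evIso F ≤ evIso G := evIso_le_of_counit ε hε
  have hGF : evIso G ≤ evIso F := evIso_le_of_unit η hη
  have : (evIso G).HasLeftCalculusOfFractions := evIso_hasLeftCalculusOfFractions η hη hFG
  obtain ⟨B', _, L, _⟩ := exists_locallySmall_localization (evIso G) fun Y ↦ by
    obtain ⟨Z, t, ht, h⟩ := exists_evIso_cofinal η hη Y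
    exact ⟨Z, t, fun i ↦ hFG _ (ht i), h⟩
  let _ : Preadditive B' := Localization.preadditive L (evIso G)
  have : L.Additive := Localization.functor_additive L (evIso G)
  have invL {X Y : B} (s : X ⟶ Y) (hs : evIso G s) : IsIso (L.map s) :=
    Localization.inverts L (evIso G) s hs
  have hF : (evIso G).IsInvertedBy (F ⋙ L) := fun X Y s hs ↦
    invL _ (hFG _ ((hGF _ hs).map))
  have hG : (evIso G).IsInvertedBy (G ⋙ L) := fun X Y s hs ↦ invL _ hs.map
  let F' : B' ⥤ B' := Localization.lift (F ⋙ L) hF L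
  let G' : B' ⥤ B' := Localization.lift (G ⋙ L) hG L
  let eF : L ⋙ F' ≅ F ⋙ L := Localization.fac _ hF L
  let eG : L ⋙ G' ≅ G ⋙ L := Localization.fac _ hG L
  have (X : B) : IsIso (L.map (ε.app X)) := invL _ (hε X)
  have (X : B) : IsIso (L.map (η.app X)) := invL _ (hFG _ (hη X))
  have : IsIso (Functor.whiskerRight ε L) := by
    have (X : B) : IsIso ((Functor.whiskerRight ε L).app X) := by
      dsimp; infer_instance
    exact NatIso.isIso_of_isIso_app _
  have : IsIso (Functor.whiskerRight η L) := by
    have (X : B) : IsIso ((Functor.whiskerRight η L).app X) := by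
      dsimp; infer_instance
    exact NatIso.isIso_of_isIso_app _
  let eFG : L ⋙ F' ⋙ G' ≅ L :=
    Functor.isoWhiskerRight eF G' ≪≫ Functor.isoWhiskerLeft F eG ≪≫
      asIso (Functor.whiskerRight ε L)
  let eGF : L ⋙ G' ⋙ F' ≅ L :=
    Functor.isoWhiskerRight eG F' ≪≫ Functor.isoWhiskerLeft G eF ≪≫
      (asIso (Functor.whiskerRight η L)).symm
  let _ : Localization.Lifting L (evIso G) L (F' ⋙ G') := ⟨eFG⟩
  let _ : Localization.Lifting L (evIso G) L (G' ⋙ F') := ⟨eGF⟩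
  let _ : Localization.Lifting L (evIso G) L (𝟭 B') := ⟨L.rightUnitor⟩
  -- `Equivalence.mk` adjusts one of the two isomorphisms so that the triangle identities hold.
  -- Later only the functors of `e` are compared with `F` and `G`, not its unit with `η`.
  let e : B' ≌ B' := CategoryTheory.Equivalence.mk F' G'
    (Localization.liftNatIso L (evIso G) L L (𝟭 B') (F' ⋙ G') (Iso.refl L))
    (Localization.liftNatIso L (evIso G) L L (G' ⋙ F') (𝟭 B') (Iso.refl L))
  have : e.functor.Additive := by
    rw [Localization.functor_additive_iff L (evIso G)]
    exact Functor.additive_of_iso eF.symm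
  have : e.inverse.Additive := by
    rw [Localization.functor_additive_iff L (evIso G)]
    exact Functor.additive_of_iso eG.symm
  exact ⟨{
    carrier := B'
    functor := L
    equivalence := e
    functorIso := eF.symm
    inverseIso := eG.symm
    isIso_map := fun s _ hs ↦ invL s hs
    exists_fraction := fun z ↦ by
      obtain ⟨φ, rfl⟩ := Localization.exists_leftFraction L (evIso G) z
      exact ⟨φ.Y', φ.f, φ.s, hGF _ φ.hs, φ.hs, by simp⟩
    exists_comp_eq_zero := fun f hf ↦ by
      obtain ⟨Y', s, hs, h⟩ := (MorphismProperty.map_eq_iff_postcomp L (evIso G) f 0).1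
        (by rw [hf, L.map_zero])
      exact ⟨Y', s, hGF _ hs, hs, by simpa using h⟩ }⟩

/-! ### Elements of the stabilized Hom-groups -/

section Elements

variable {A : Type u} [Category.{v} A] [Abelian A] {P : ObjectProperty A}
  [P.IsClosedUnderFiniteProducts] (F : StableCategory P ⥤ StableCategory P) [F.Additive] (a b : ℕ)

/-- The transition morphisms in the colimit that defines `stabilizedHom`. -/
abbrev stabilizedHomDiagram : ℕ ⥤ (Aᵒᵖ ⥤ A ⥤ AddCommGrpCat.{v}) :=
  Functor.ofSequence
    (X := fun k : ℕ ↦ stableHom (iterFunctor F (a + k)) (iterFunctor F (b + k)))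
    (fun k ↦ stableHomShift F (iterFunctor F (a + k)) (iterFunctor F (b + k)))

/-- The class of a morphism `F^(a+k) M ⟶ F^(b+k) N` in the stabilized Hom-group. -/
def stabilizedHomMk (M N : A) (k : ℕ) :
    ((iterFunctor F (a + k)).obj M ⟶ (iterFunctor F (b + k)).obj N) →+
      ((stabilizedHom F a b).obj (op M)).obj N :=
  (((colimit.ι (stabilizedHomDiagram F a b) k).app (op M)).app N).hom

/-- The stabilized Hom-group of two objects as a colimit of abelian groups. -/
def isColimitStabilizedHom (M N : A) : IsColimit
    (((evaluation Aᵒᵖ (A ⥤ AddCommGrpCat.{v})).obj (op M) ⋙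
      (evaluation A AddCommGrpCat.{v}).obj N).mapCocone
        (colimit.cocone (stabilizedHomDiagram F a b))) :=
  isColimitOfPreserves _ (colimit.isColimit _)

lemma exists_stabilizedHomMk_eq (M N : A) (y : ((stabilizedHom F a b).obj (op M)).obj N) :
    ∃ (k : ℕ) (x : (iterFunctor F (a + k)).obj M ⟶ (iterFunctor F (b + k)).obj N),
      stabilizedHomMk F a b M N k x = y := by
  have : PreservesFilteredColimitsOfSize.{0, 0} (forget AddCommGrpCat.{v}) :=
    preservesFilteredColimitsOfSize_shrink.{0, v, 0, v} _
  exact Concrete.isColimit_exists_rep _ (isColimitStabilizedHom F a b M N) y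

lemma stabilizedHomMk_succ (M N : A) (k : ℕ)
    (x : (iterFunctor F (a + k)).obj M ⟶ (iterFunctor F (b + k)).obj N) :
    stabilizedHomMk F a b M N (k + 1) (F.map x) = stabilizedHomMk F a b M N k x := by
  have h := colimit.w (stabilizedHomDiagram F a b) (homOfLE (Nat.le_add_right k 1))
  rw [show (stabilizedHomDiagram F a b).map (homOfLE (Nat.le_add_right k 1)) = _ from
    Functor.ofSequence_map_homOfLE_succ _ k] at h
  exact ConcreteCategory.congr_hom (congr_app (congr_app h (op M)) N) x

/-- In a filtered colimit an element dies at a finite stage, and the transition maps are iterates of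
`F`. -/
lemma exists_endoPow_map_eq_zero_of_stabilizedHomMk_eq_zero (M N : A) (k : ℕ)
    (x : (iterFunctor F (a + k)).obj M ⟶ (iterFunctor F (b + k)).obj N)
    (hx : stabilizedHomMk F a b M N k x = 0) : ∃ l, (endoPow F l).map x = 0 := by
  have : PreservesFilteredColimitsOfSize.{0, 0} (forget AddCommGrpCat.{v}) :=
    preservesFilteredColimitsOfSize_shrink.{0, v, 0, v} _
  obtain ⟨j, f, g, h⟩ := Concrete.isColimit_exists_of_rep_eq
    (i := k) (j := k) _ (isColimitStabilizedHom F a b M N) x 0 (hx.trans (map_zero _).symm)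
  obtain rfl := Subsingleton.elim f g
  rw [map_zero] at h
  let t (j : ℕ) (hkj : k ≤ j) := (((stabilizedHomDiagram F a b).map (homOfLE hkj)).app (op M)).app N
  -- Descending from stage `j` to stage `k` one step at a time avoids identifying objects such as
  -- `F^(j-k) (F^(a+k) M)` and `F^(a+j) M`.
  have key : ∀ (j : ℕ) (hkj : k ≤ j), (∃ l, (endoPow F l).map (t j hkj x) = 0) →
      ∃ l, (endoPow F l).map x = 0 := by
    intro j hkj
    induction j, hkj using Nat.le_induction with
    | base =>
      rintro ⟨l, hl⟩
      have h0 : (stabilizedHomDiagram F a b).map (homOfLE le_rfl : k ⟶ k) = 𝟙 _ :=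
        (stabilizedHomDiagram F a b).map_id k
      refine ⟨l, ?_⟩
      rwa [show t k le_rfl x = x from
        ConcreteCategory.congr_hom (congr_app (congr_app h0 (op M)) N) x] at hl
    | succ j hkj ih =>
      rintro ⟨l, hl⟩
      refine ih ⟨l + 1, ?_⟩
      have h1 : (stabilizedHomDiagram F a b).map (homOfLE (hkj.trans (Nat.le_succ j))) =
          (stabilizedHomDiagram F a b).map (homOfLE hkj) ≫
            stableHomShift F (iterFunctor F (a + j)) (iterFunctor F (b + j)) :=
        ((stabilizedHomDiagram F a b).map_comp (homOfLE hkj)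
          (homOfLE (Nat.le_add_right j 1))).trans
          (congrArg (fun g ↦ (stabilizedHomDiagram F a b).map (homOfLE hkj) ≫ g)
            (Functor.ofSequence_map_homOfLE_succ _ j))
      rwa [show t (j + 1) (hkj.trans (Nat.le_succ j)) x = F.map (t j hkj x) from
        ConcreteCategory.congr_hom (congr_app (congr_app h1 (op M)) N) x] at hl
  exact key j (leOfHom f) ⟨0, h⟩

lemma stabilizedHomMk_eq_zero (M N : A) (k : ℕ)
    (x : (iterFunctor F (a + k)).obj M ⟶ (iterFunctor F (b + k)).obj N)
    (l : ℕ) (hl : (endoPow F l).map x = 0) : stabilizedHomMk F a b M N k x = 0 := by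
  induction l generalizing k with
  | zero =>
    obtain rfl : x = 0 := hl
    exact map_zero _
  | succ l ih => exact (stabilizedHomMk_succ F a b M N k x).symm.trans (ih (k + 1) (F.map x) hl)

end Elements
/-! ### Hom-bifunctors pulled back along functors -/

section HomBif

variable {A : Type*} [Category* A] {B : Type*} [Category.{v} B] [Preadditive B]

/-- The bifunctor `(M, N) ↦ Hom(G M, H N)` with values in abelian groups. -/
def homBif (G H : A ⥤ B) : Aᵒᵖ ⥤ A ⥤ AddCommGrpCat.{v} :=
  G.op ⋙ preadditiveCoyoneda ⋙ (Functor.whiskeringLeft _ _ _).obj H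

/-- `homBif` respects isomorphisms of functors. -/
def homBifCongr {G G' H H' : A ⥤ B} (e : G ≅ G') (e' : H ≅ H') : homBif G H ≅ homBif G' H' :=
  Functor.isoWhiskerRight (NatIso.op e.symm) _ ≪≫
    Functor.isoWhiskerLeft G'.op (Functor.isoWhiskerLeft preadditiveCoyoneda
      ((Functor.whiskeringLeft A B AddCommGrpCat.{v}).mapIso e'))

lemma homBifCongr_hom_app {G G' H H' : A ⥤ B} (e : G ≅ G') (e' : H ≅ H') (M N : A)
    (z : G.obj M ⟶ H.obj N) :
    (((homBifCongr e e').hom.app (op M)).app N).hom z = e.inv.app M ≫ z ≫ e'.hom.app N := by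
  exact Category.assoc _ _ _

/-- A fully faithful additive functor induces an isomorphism on Hom-groups. -/
def homBifIsoComp {B' : Type*} [Category.{v} B'] [Preadditive B'] (G H : A ⥤ B) (F : B ⥤ B')
    [F.Additive] [F.Full] [F.Faithful] : homBif G H ≅ homBif (G ⋙ F) (H ⋙ F) :=
  NatIso.ofComponents (fun M ↦ NatIso.ofComponents (fun N ↦
    AddEquiv.toAddCommGrpIso
      { (Functor.FullyFaithful.ofFullyFaithful F).homEquiv with
        map_add' := fun x y : G.obj M.unop ⟶ H.obj N ↦ F.map_add })
      (fun f ↦ by ext x; exact F.map_comp x (H.map f)))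
    (fun f ↦ by ext N x; exact F.map_comp (G.map f.unop) x)

/-- The composition of `R` with the iterates of an endofunctor. -/
def compPow (R : A ⥤ B) (F : B ⥤ B) : ℕ → (A ⥤ B)
  | 0 => R
  | k + 1 => compPow R F k ⋙ F

omit [Preadditive B] in
lemma compPow_comp (R : A ⥤ B) (F : B ⥤ B) (k : ℕ) :
    compPow (R ⋙ F) F k = compPow R F (k + 1) := by
  induction k with
  | zero => rfl
  | succ k ih => exact congrArg (· ⋙ F) ih

/-- Applying the inverse to both arguments removes one iterate on the left and adds one on the
right. -/
lemma nonempty_homBif_compPow_iso (e : B ≌ B) [e.inverse.Additive] (R H : A ⥤ B) (a : ℕ) :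
    Nonempty (homBif (compPow R e.functor a) H ≅ homBif R (compPow H e.inverse a)) := by
  induction a generalizing H with
  | zero => exact ⟨Iso.refl _⟩
  | succ a ih =>
    obtain ⟨i⟩ := ih (H ⋙ e.inverse)
    rw [compPow_comp] at i
    exact ⟨homBifIsoComp _ _ e.inverse ≪≫
      homBifCongr (Functor.isoWhiskerLeft (compPow R e.functor a) e.unitIso.symm) (Iso.refl _)
        ≪≫ i⟩

/-- Moving iterates of an autoequivalence to the other argument, when one exponent vanishes. -/
lemma nonempty_homBif_compPow_iso_inverse (e : B ≌ B) [e.functor.Additive] [e.inverse.Additive]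
    (R : A ⥤ B) {a b : ℕ} (hab : a = 0 ∨ b = 0) :
    Nonempty (homBif (compPow R e.functor a) (compPow R e.functor b) ≅
      homBif (compPow R e.inverse b) (compPow R e.inverse a)) := by
  obtain rfl | rfl := hab
  · have : e.symm.inverse.Additive := inferInstanceAs e.functor.Additive
    exact (nonempty_homBif_compPow_iso e.symm R R b).map Iso.symm
  · exact nonempty_homBif_compPow_iso e R R a

end HomBif

/-! ### Comparing stabilized Hom-groups with Hom-groups in which the endofunctor is invertible -/

section Comparison

variable {A : Type u} [Category.{v} A] [Abelian A] {P : ObjectProperty A}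
  [P.IsClosedUnderFiniteProducts] {F : StableCategory P ⥤ StableCategory P}
  {B : Type u} [Category.{v} B] {L : StableCategory P ⥤ B} {E : B ⥤ B}

/-- The morphism `L X ⟶ L Y` becomes the image of a morphism after `n` applications of `F`. -/
def IsRepresentedAfter (φ : F ⋙ L ≅ L ⋙ E) :
    ℕ → ∀ {X Y : StableCategory P}, (L.obj X ⟶ L.obj Y) → Prop
  | 0, _, _, z => ∃ x, L.map x = z
  | n + 1, X, Y, z => IsRepresentedAfter φ n (X := F.obj X) (Y := F.obj Y)
      (φ.hom.app X ≫ E.map z ≫ φ.inv.app Y)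

/-- The composition of `L` with an iterate of `F`, in terms of the functor `E` extending `F`. -/
def iterFunctorCompIso (φ : F ⋙ L ≅ L ⋙ E) :
    ∀ k, iterFunctor F k ⋙ L ≅ compPow (stableFunctor P ⋙ L) E k
  | 0 => Iso.refl _
  | k + 1 => Functor.isoWhiskerLeft (iterFunctor F k) φ ≪≫
      Functor.isoWhiskerRight (iterFunctorCompIso φ k) E

variable [Preadditive B] [F.Additive] [L.Additive] [E.Additive] [E.Full] [E.Faithful]

/-- The action of `L` on morphisms between stable objects. -/
def stableHomMap (L : StableCategory P ⥤ B) [L.Additive] (G H : A ⥤ StableCategory P) :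
    stableHom G H ⟶ homBif (G ⋙ L) (H ⋙ L) where
  app M :=
    { app := fun N ↦ AddCommGrpCat.ofHom
        (L.mapAddHom : (G.obj M.unop ⟶ H.obj N) →+ (L.obj (G.obj M.unop) ⟶ L.obj (H.obj N)))
      naturality := fun N N' f ↦ by
        ext x
        exact L.map_comp x (H.map f) }
  naturality M M' f := by
    ext N x
    exact L.map_comp (G.map f.unop) x

/-- Removing iterates of a fully faithful functor from both arguments. -/
def homBifCompPowIso (R : A ⥤ B) (E : B ⥤ B) [E.Additive] [E.Full] [E.Faithful] (a b : ℕ) :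
    ∀ k, homBif (compPow R E (a + k)) (compPow R E (b + k)) ≅
      homBif (compPow R E a) (compPow R E b)
  | 0 => Iso.refl _
  | k + 1 => (homBifIsoComp _ _ E).symm ≪≫ homBifCompPowIso R E a b k

/-- The comparison morphism on the terms of the colimit. -/
def comparisonApp (φ : F ⋙ L ≅ L ⋙ E) (a b k : ℕ) :
    stableHom (iterFunctor F (a + k)) (iterFunctor F (b + k)) ⟶
      homBif (compPow (stableFunctor P ⋙ L) E (a + k)) (compPow (stableFunctor P ⋙ L) E (b + k)) :=
  stableHomMap L _ _ ≫
    (homBifCongr (iterFunctorCompIso φ (a + k)) (iterFunctorCompIso φ (b + k))).hom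

omit [F.Additive] [E.Additive] [E.Full] [E.Faithful] in
lemma comparisonApp_app (φ : F ⋙ L ≅ L ⋙ E) (a b k : ℕ) (M N : A)
    (x : (iterFunctor F (a + k)).obj M ⟶ (iterFunctor F (b + k)).obj N) :
    (((comparisonApp φ a b k).app (op M)).app N).hom x =
      (iterFunctorCompIso φ (a + k)).inv.app M ≫ L.map x ≫
        (iterFunctorCompIso φ (b + k)).hom.app N :=
  homBifCongr_hom_app (iterFunctorCompIso φ (a + k)) (iterFunctorCompIso φ (b + k)) M N (L.map x)

/-- By naturality of `φ`, the transition map `x ↦ F x` corresponds to applying `E`. Since `E` is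
fully faithful, the target system is constant up to isomorphism, which gives the map out of the
colimit. -/
lemma stableHomShift_comparisonApp (φ : F ⋙ L ≅ L ⋙ E) (a b k : ℕ) :
    stableHomShift F (iterFunctor F (a + k)) (iterFunctor F (b + k)) ≫
      comparisonApp φ a b (k + 1) = comparisonApp φ a b k ≫ (homBifIsoComp _ _ E).hom := by
  ext M N x
  refine (comparisonApp_app φ a b (k + 1) M.unop N (F.map x)).trans
    (Eq.trans ?_ (congrArg (fun z ↦ E.map z) (comparisonApp_app φ a b k M.unop N x)).symm)
  have h₁ : (iterFunctorCompIso φ (a + (k + 1))).inv.app M.unop =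
      E.map ((iterFunctorCompIso φ (a + k)).inv.app M.unop) ≫ φ.inv.app _ := rfl
  have h₂ : (iterFunctorCompIso φ (b + (k + 1))).hom.app N =
      φ.hom.app _ ≫ E.map ((iterFunctorCompIso φ (b + k)).hom.app N) := rfl
  have h : φ.inv.app _ ≫ L.map (F.map x) ≫ φ.hom.app _ = E.map (L.map x) :=
    NatIso.naturality_1 φ x
  rw [h₁, h₂, E.map_comp, E.map_comp, ← h]
  simp only [Category.assoc]
  exact Category.assoc _ _ _

/-- The comparison from the stabilized Hom-groups to Hom-groups in which `F` is invertible. -/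
def comparison (φ : F ⋙ L ≅ L ⋙ E) (a b : ℕ) :
    stabilizedHom F a b ⟶
      homBif (compPow (stableFunctor P ⋙ L) E a) (compPow (stableFunctor P ⋙ L) E b) :=
  colimit.desc (stabilizedHomDiagram F a b)
    { pt := _
      ι := NatTrans.ofSequence (fun k ↦ comparisonApp φ a b k ≫ (homBifCompPowIso _ E a b k).hom)
        (fun k ↦ by
          refine (congrArg (· ≫ (comparisonApp φ a b (k + 1) ≫
              (homBifCompPowIso _ E a b (k + 1)).hom))
            (Functor.ofSequence_map_homOfLE_succ
              (fun k ↦ stableHomShift F (iterFunctor F (a + k)) (iterFunctor F (b + k)))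
              k)).trans ?_
          refine (Category.assoc _ _ _).symm.trans ?_
          refine (congrArg (· ≫ (homBifCompPowIso _ E a b (k + 1)).hom)
            (stableHomShift_comparisonApp φ a b k)).trans ?_
          refine Eq.trans ?_ (Category.comp_id _).symm
          refine (Category.assoc _ _ _).trans ?_
          congr 1
          exact Iso.hom_inv_id_assoc (homBifIsoComp _ _ E) _) }

lemma comparison_mk (φ : F ⋙ L ≅ L ⋙ E) (a b k : ℕ) (M N : A)
    (x : (iterFunctor F (a + k)).obj M ⟶ (iterFunctor F (b + k)).obj N) :
    (((comparison φ a b).app (op M)).app N).hom (stabilizedHomMk F a b M N k x) =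
      (((homBifCompPowIso (stableFunctor P ⋙ L) E a b k).hom.app (op M)).app N).hom
        ((((comparisonApp φ a b k).app (op M)).app N).hom x) := by
  have h : colimit.ι (stabilizedHomDiagram F a b) k ≫ comparison φ a b =
      comparisonApp φ a b k ≫ (homBifCompPowIso (stableFunctor P ⋙ L) E a b k).hom :=
    colimit.ι_desc _ k
  exact ConcreteCategory.congr_hom (congr_app (congr_app h (op M)) N) x

omit [Abelian A] in
lemma homBifCompPowIso_hom_injective (R : A ⥤ B) (a b k : ℕ) (M N : A) : Function.Injective
    (((homBifCompPowIso R E a b k).hom.app (op M)).app N).hom :=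
  ((AddCommGrpCat.mono_iff_injective _).1 inferInstance)

/-- All ingredients of the comparison other than `L` are isomorphisms, so an element of the kernel
has a representative killed by `L`. -/
lemma comparison_injective (φ : F ⋙ L ≅ L ⋙ E)
    (hL : ∀ {X Y : StableCategory P} (x : X ⟶ Y), L.map x = 0 →
      ∃ k, (endoPow F k).map x = 0) (a b : ℕ) (M N : A) :
    Function.Injective (((comparison φ a b).app (op M)).app N).hom := by
  rw [injective_iff_map_eq_zero]
  intro y hy
  obtain ⟨k, x, rfl⟩ := exists_stabilizedHomMk_eq F a b M N y
  rw [comparison_mk] at hy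
  have h := homBifCompPowIso_hom_injective _ a b k M N (hy.trans (map_zero _).symm)
  rw [comparisonApp_app] at h
  obtain ⟨l, hl⟩ := hL x <| by
    rw [← cancel_mono ((iterFunctorCompIso φ (b + k)).hom.app N),
      ← cancel_epi ((iterFunctorCompIso φ (a + k)).inv.app M), zero_comp, comp_zero]
    exact h
  exact stabilizedHomMk_eq_zero F a b M N k x l hl

lemma comparison_surjective (φ : F ⋙ L ≅ L ⋙ E)
    (hL : ∀ {X Y : StableCategory P} (z : L.obj X ⟶ L.obj Y), ∃ n, IsRepresentedAfter φ n z)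
    (a b : ℕ) (M N : A) :
    Function.Surjective (((comparison φ a b).app (op M)).app N).hom := by
  -- One application of `E` is traded for one stage of the colimit: a morphism represented after `n
  -- + 1` steps at stage `k` is represented after `n` steps at stage `k + 1`.
  have key (n : ℕ) : ∀ (k : ℕ) (z : (compPow (stableFunctor P ⋙ L) E (a + k)).obj M ⟶
        (compPow (stableFunctor P ⋙ L) E (b + k)).obj N),
      IsRepresentedAfter φ n ((iterFunctorCompIso φ (a + k)).hom.app M ≫ z ≫
        (iterFunctorCompIso φ (b + k)).inv.app N) →
      ∃ y, (((comparison φ a b).app (op M)).app N).hom y =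
        (((homBifCompPowIso (stableFunctor P ⋙ L) E a b k).hom.app (op M)).app N).hom z := by
    induction n with
    | zero =>
      rintro k z ⟨x, hx⟩
      refine ⟨stabilizedHomMk F a b M N k x, ?_⟩
      rw [comparison_mk, comparisonApp_app, hx]
      congr 1
      simp only [Category.assoc, Iso.inv_hom_id_app, Iso.inv_hom_id_app_assoc]
      exact Category.comp_id z
    | succ n ih =>
      intro k z hz
      have h₁ : (iterFunctorCompIso φ (a + (k + 1))).hom.app M =
        φ.hom.app _ ≫ E.map ((iterFunctorCompIso φ (a + k)).hom.app M) := rfl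
      have h₂ : (iterFunctorCompIso φ (b + (k + 1))).inv.app N =
        E.map ((iterFunctorCompIso φ (b + k)).inv.app N) ≫ φ.inv.app _ := rfl
      have h₃ : (iterFunctorCompIso φ (a + (k + 1))).hom.app M ≫ E.map z ≫
          (iterFunctorCompIso φ (b + (k + 1))).inv.app N =
          φ.hom.app _ ≫ E.map ((iterFunctorCompIso φ (a + k)).hom.app M ≫ z ≫
            (iterFunctorCompIso φ (b + k)).inv.app N) ≫ φ.inv.app _ := by
        rw [h₁, h₂, E.map_comp, E.map_comp]
        simp only [Category.assoc]
        exact Category.assoc _ _ _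
      obtain ⟨y, hy⟩ := ih (k + 1) (E.map z)
        ((congrArg (IsRepresentedAfter φ n) h₃).mpr hz)
      refine ⟨y, hy.trans ?_⟩
      have h : (homBifIsoComp (compPow (stableFunctor P ⋙ L) E (a + k))
          (compPow (stableFunctor P ⋙ L) E (b + k)) E).hom ≫
          (homBifCompPowIso (stableFunctor P ⋙ L) E a b (k + 1)).hom =
          (homBifCompPowIso (stableFunctor P ⋙ L) E a b k).hom :=
        Iso.hom_inv_id_assoc _ _
      exact ConcreteCategory.congr_hom (congr_app (congr_app h (op M)) N) z
  intro z
  obtain ⟨n, hn⟩ := hL ((iterFunctorCompIso φ a).hom.app M ≫ z ≫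
    (iterFunctorCompIso φ b).inv.app N)
  exact key n 0 z hn

theorem isIso_comparison (φ : F ⋙ L ≅ L ⋙ E)
    (hL : ∀ {X Y : StableCategory P} (x : X ⟶ Y), L.map x = 0 → ∃ k, (endoPow F k).map x = 0)
    (hL' : ∀ {X Y : StableCategory P} (z : L.obj X ⟶ L.obj Y), ∃ n, IsRepresentedAfter φ n z)
    (a b : ℕ) : IsIso (comparison φ a b) := by
  have (M : Aᵒᵖ) : IsIso ((comparison φ a b).app M) := by
    have (N : A) : IsIso (((comparison φ a b).app M).app N) :=
      (ConcreteCategory.isIso_iff_bijective _).2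
        ⟨comparison_injective φ hL a b M.unop N, comparison_surjective φ hL' a b M.unop N⟩
    exact NatIso.isIso_of_isIso_app _
  exact NatIso.isIso_of_isIso_app _

end Comparison

/-! ### Rotating proper short exact sequences -/

section Rotation

variable {A : Type u} [Category.{v} A] [Abelian A]

/-- Every morphism from the left term of `S` to an object of `Y` extends to the middle term. -/
def HomToSurjective (Y : ObjectProperty A) (S : ShortComplex A) : Prop :=
  ∀ Z : A, Y Z → ∀ f : S.X₁ ⟶ Z, ∃ g : S.X₂ ⟶ Z, S.f ≫ g = f

/-- Every morphism from an object of `X` to the right term of `S` lifts to the middle term. -/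
def HomFromSurjective (X : ObjectProperty A) (S : ShortComplex A) : Prop :=
  ∀ Z : A, X Z → ∀ f : Z ⟶ S.X₃, ∃ g : Z ⟶ S.X₂, g ≫ S.g = f

lemma exists_desc_of_shortExact {S : ShortComplex A} (hS : S.ShortExact) {Z : A} (e : S.X₂ ⟶ Z)
    (he : S.f ≫ e = 0) : ∃ c : S.X₃ ⟶ Z, S.g ≫ c = e := by
  have := hS.epi_g
  exact ⟨hS.exact.desc e he, hS.exact.g_desc e he⟩

lemma exists_lift_of_shortExact {S : ShortComplex A} (hS : S.ShortExact) {Z : A} (e : Z ⟶ S.X₂)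
    (he : e ≫ S.g = 0) : ∃ c : Z ⟶ S.X₁, c ≫ S.f = e := by
  have := hS.mono_f
  exact ⟨hS.exact.lift e he, hS.exact.lift_f e he⟩

section

variable {X Y Z I X' : A} {f : X ⟶ Y} {p : Y ⟶ Z} {w : f ≫ p = 0} {ι : X ⟶ I} {π : I ⟶ X'}
  {w' : ι ≫ π = 0} {e : Y ⟶ I} {c : Z ⟶ X'}

/-- Analogue of rotating a triangle: `X ⟶ Y ⟶ Z` becomes `Y ⟶ Z ⊞ I ⟶ X'`, with `X'` in the role of
`ΣX`. The maps `e` and `c` form a morphism of short exact sequences that is the identity on `X`, so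
its right-hand square is bicartesian. -/
lemma rotate_shortExact (hS : (ShortComplex.mk f p w).ShortExact)
    (hT : (ShortComplex.mk ι π w').ShortExact) (he : f ≫ e = ι) (hc : p ≫ c = e ≫ π) :
    (ShortComplex.mk (biprod.lift p e) (biprod.desc c (-π)) (by simp [hc])).ShortExact := by
  have := hS.mono_f
  have : Epi p := hS.epi_g
  have : Mono ι := hT.mono_f
  have : Epi π := hT.epi_g
  refine ShortComplex.ShortExact.mk' ?_ ?_ ?_
  · rw [ShortComplex.exact_iff_exact_up_to_refinements]
    intro W u hu
    dsimp at u hu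
    obtain ⟨W', q, _, y, hy⟩ := surjective_up_to_refinements_of_epi p (u ≫ biprod.fst)
    have h0 : (q ≫ u ≫ biprod.snd - y ≫ e) ≫ π = 0 := by
      have hu' : u ≫ biprod.fst ≫ c - u ≫ biprod.snd ≫ π = 0 := by
        rw [← hu, biprod.desc_eq]; simp [sub_eq_add_neg]
      have h1 := hy =≫ c
      simp only [Category.assoc, hc] at h1
      simp only [Preadditive.sub_comp, Category.assoc]
      rw [← h1, sub_eq_zero.1 hu', sub_self]
    obtain ⟨x, hx⟩ := exists_lift_of_shortExact hT _ h0
    dsimp at x hx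
    refine ⟨W', q, inferInstance, y + x ≫ f, ?_⟩
    ext
    · simp [← hy, w]
    · simp [he, hx]
  · refine (Preadditive.mono_iff_cancel_zero _).2 fun W u hu ↦ ?_
    dsimp at u hu
    have h1 : u ≫ p = 0 := by simpa using hu =≫ biprod.fst
    have h2 : u ≫ e = 0 := by simpa using hu =≫ biprod.snd
    obtain ⟨x, rfl⟩ := exists_lift_of_shortExact hS u h1
    dsimp at x h2 ⊢
    rw [Category.assoc, he] at h2
    rw [zero_of_comp_mono ι h2, zero_comp]
  · have : Epi (biprod.inr ≫ biprod.desc c (-π)) := by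
      rw [biprod.inr_desc]; infer_instance
    exact epi_of_epi biprod.inr (biprod.desc c (-π))

/-- Only the second sequence has to be proper: after subtracting an extension over `I`, the given
morphism vanishes on `X` and descends to `Z`. -/
lemma rotate_homToSurjective {C : ObjectProperty A} (hS : (ShortComplex.mk f p w).ShortExact)
    (hT : HomToSurjective C (ShortComplex.mk ι π w')) (he : f ≫ e = ι) (hc : p ≫ c = e ≫ π) :
    HomToSurjective C
      (ShortComplex.mk (biprod.lift p e) (biprod.desc c (-π)) (by simp [hc])) := by
  intro J hJ h
  dsimp at h ⊢
  obtain ⟨t, ht⟩ := hT J hJ (f ≫ h)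
  dsimp at t ht
  obtain ⟨s, hs⟩ := exists_desc_of_shortExact hS (h - e ≫ t) (by
    dsimp; rw [Preadditive.comp_sub, ← Category.assoc, he, ht, sub_self])
  dsimp at s hs
  exact ⟨biprod.desc s t, by simp [hs]⟩

/-- The direct sum of a short exact sequence and of an identity morphism on the left. -/
lemma shortExact_biprod_map_id (hT : (ShortComplex.mk ι π w').ShortExact) (J : A) :
    (ShortComplex.mk (biprod.map ι (𝟙 J)) (biprod.fst ≫ π) (by simp [w'])).ShortExact := by
  have : Mono ι := hT.mono_f
  have : Epi π := hT.epi_g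
  refine ShortComplex.ShortExact.mk' ?_ ?_ ?_
  · rw [ShortComplex.exact_iff_exact_up_to_refinements]
    intro W u hu
    dsimp at u hu
    obtain ⟨x, hx⟩ := exists_lift_of_shortExact hT (u ≫ biprod.fst) (by simpa using hu)
    dsimp at x hx
    refine ⟨W, 𝟙 W, inferInstance, biprod.lift x (u ≫ biprod.snd), ?_⟩
    ext <;> simp [hx]
  · dsimp; infer_instance
  · dsimp; infer_instance

lemma homToSurjective_biprod_map_id {C : ObjectProperty A}
    (hT : HomToSurjective C (ShortComplex.mk ι π w')) (J : A) : HomToSurjective C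
      (ShortComplex.mk (biprod.map ι (𝟙 J)) (biprod.fst ≫ π) (by simp [w'])) := by
  intro K hK h
  dsimp at h ⊢
  obtain ⟨t, ht⟩ := hT K hK (biprod.inl ≫ h)
  dsimp at t ht
  refine ⟨biprod.desc t (biprod.inr ≫ h), ?_⟩
  ext <;> simp [ht]

end

section

variable {X Y Z I Z' : A} {f : X ⟶ Y} {p : Y ⟶ Z} {w : f ≫ p = 0} {ι : Z' ⟶ I} {π : I ⟶ Z}
  {w' : ι ≫ π = 0} {e : I ⟶ Y} {c : Z' ⟶ X}

/-- Rotation in the other direction: `X ⟶ Y ⟶ Z` becomes `Z' ⟶ X ⊞ I ⟶ Y`, with `Z'` in the role of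
`ΩZ`. -/
lemma inverse_rotate_shortExact (hS : (ShortComplex.mk f p w).ShortExact)
    (hT : (ShortComplex.mk ι π w').ShortExact) (he : e ≫ p = π) (hc : c ≫ f = ι ≫ e) :
    (ShortComplex.mk (biprod.lift c (-ι)) (biprod.desc f e) (by simp [hc])).ShortExact := by
  have : Mono f := hS.mono_f
  have : Epi p := hS.epi_g
  have : Mono ι := hT.mono_f
  have : Epi π := hT.epi_g
  refine ShortComplex.ShortExact.mk' ?_ ?_ ?_
  · rw [ShortComplex.exact_iff_exact_up_to_refinements]
    intro W u hu
    dsimp at u hu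
    have hu' : u ≫ biprod.fst ≫ f + u ≫ biprod.snd ≫ e = 0 := by
      rw [← hu, biprod.desc_eq]; simp
    obtain ⟨z, hz⟩ := exists_lift_of_shortExact hT (u ≫ biprod.snd) (by
      have h := hu' =≫ p
      simpa [w, he] using h)
    dsimp at z hz
    refine ⟨W, 𝟙 W, inferInstance, -z, ?_⟩
    apply biprod.hom_ext
    · rw [← cancel_mono f]
      have h := hz =≫ e
      simp only [Category.assoc] at h
      simp [hc, h, eq_neg_of_add_eq_zero_left hu']
    · simp [hz]
  · have : Mono (biprod.lift c (-ι) ≫ biprod.snd) := by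
      rw [biprod.lift_snd]; infer_instance
    exact mono_of_mono (biprod.lift c (-ι)) biprod.snd
  · refine (Preadditive.epi_iff_cancel_zero _).2 fun W u hu ↦ ?_
    dsimp at u hu
    have h1 : f ≫ u = 0 := by simpa using biprod.inl ≫= hu
    have h2 : e ≫ u = 0 := by simpa using biprod.inr ≫= hu
    obtain ⟨x, rfl⟩ := exists_desc_of_shortExact hS u h1
    dsimp at x h2 ⊢
    rw [← Category.assoc, he] at h2
    rw [zero_of_epi_comp π h2, comp_zero]

lemma inverse_rotate_homFromSurjective {D : ObjectProperty A}
    (hS : (ShortComplex.mk f p w).ShortExact) (hT : HomFromSurjective D (ShortComplex.mk ι π w'))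
    (he : e ≫ p = π) (hc : c ≫ f = ι ≫ e) : HomFromSurjective D
      (ShortComplex.mk (biprod.lift c (-ι)) (biprod.desc f e) (by simp [hc])) := by
  intro J hJ h
  dsimp at h ⊢
  obtain ⟨t, ht⟩ := hT J hJ (h ≫ p)
  dsimp at t ht
  obtain ⟨s, hs⟩ := exists_lift_of_shortExact hS (h - t ≫ e) (by
    dsimp; rw [Preadditive.sub_comp, Category.assoc, he, ht, sub_self])
  dsimp at s hs
  exact ⟨biprod.lift s t, by simp [hs]⟩

/-- The direct sum of a short exact sequence and of an identity morphism on the right. -/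
lemma shortExact_biprod_map_id_right (hT : (ShortComplex.mk ι π w').ShortExact) (J : A) :
    (ShortComplex.mk (ι ≫ biprod.inl) (biprod.map π (𝟙 J)) (by
      simp [reassoc_of% w'])).ShortExact := by
  have : Mono ι := hT.mono_f
  have : Epi π := hT.epi_g
  refine ShortComplex.ShortExact.mk' ?_ ?_ ?_
  · rw [ShortComplex.exact_iff_exact_up_to_refinements]
    intro W u hu
    dsimp at u hu
    obtain ⟨x, hx⟩ := exists_lift_of_shortExact hT (u ≫ biprod.fst) (by
      simpa using hu =≫ biprod.fst)
    dsimp at x hx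
    refine ⟨W, 𝟙 W, inferInstance, x, ?_⟩
    apply biprod.hom_ext
    · simp [reassoc_of% hx]
    · simpa using hu =≫ biprod.snd
  · dsimp; infer_instance
  · dsimp; infer_instance

lemma homFromSurjective_biprod_map_id {D : ObjectProperty A}
    (hT : HomFromSurjective D (ShortComplex.mk ι π w')) (J : A) : HomFromSurjective D
      (ShortComplex.mk (ι ≫ biprod.inl) (biprod.map π (𝟙 J)) (by simp [reassoc_of% w'])) := by
  intro K hK h
  dsimp at h ⊢
  obtain ⟨t, ht⟩ := hT K hK (h ≫ biprod.fst)
  dsimp at t ht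
  refine ⟨biprod.lift t (h ≫ biprod.snd), ?_⟩
  apply biprod.hom_ext <;> simp [ht]

end

end Rotation

/-! ### Morphisms inverted by iterated cosyzygies -/

section StableIso

variable {A : Type u} [Category.{v} A] [Abelian A] {P : ObjectProperty A}
  [P.IsClosedUnderFiniteProducts]

lemma stableFunctor_map_eq_zero_iff {M N : A} (f : M ⟶ N) :
    (stableFunctor P).map f = 0 ↔ FactorsThrough P f := by
  rw [← (stableFunctor P).map_zero, stableFunctor_map_eq_iff, sub_zero]

lemma isZero_stableFunctor_obj {M : A} (hM : P M) : IsZero ((stableFunctor P).obj M) := by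
  rw [IsZero.iff_id_eq_zero, ← (stableFunctor P).map_id, stableFunctor_map_eq_zero_iff]
  exact ⟨M, hM, 𝟙 M, 𝟙 M, by simp⟩

/-- Closure under direct summands enters here: an object whose identity factors through `P` is a
retract of an object of `P`. -/
lemma isZero_stableFunctor_obj_iff [P.IsStableUnderRetracts] {M : A} :
    IsZero ((stableFunctor P).obj M) ↔ P M := by
  refine ⟨fun h ↦ ?_, isZero_stableFunctor_obj⟩
  rw [IsZero.iff_id_eq_zero, ← (stableFunctor P).map_id, stableFunctor_map_eq_zero_iff] at h
  obtain ⟨X, hX, g, h, hgh⟩ := h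
  exact P.prop_of_retract ⟨g, h, hgh⟩ hX

lemma isIso_stableFunctor_map_inl (M : A) {J : A} (hJ : P J) :
    IsIso ((stableFunctor P).map (biprod.inl : M ⟶ M ⊞ J)) := by
  refine ⟨(stableFunctor P).map biprod.fst, ?_, ?_⟩
  · rw [← Functor.map_comp, biprod.inl_fst, CategoryTheory.Functor.map_id]
  · rw [← Functor.map_comp, ← CategoryTheory.Functor.map_id, stableFunctor_map_eq_iff]
    exact ⟨J, hJ, -biprod.snd, biprod.inr, by apply biprod.hom_ext <;> simp⟩

lemma isIso_stableFunctor_map_fst (M : A) {J : A} (hJ : P J) :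
    IsIso ((stableFunctor P).map (biprod.fst : M ⊞ J ⟶ M)) := by
  have := isIso_stableFunctor_map_inl M hJ
  have h : (stableFunctor P).map (biprod.inl : M ⟶ M ⊞ J) ≫ (stableFunctor P).map biprod.fst =
      𝟙 _ := by
    rw [← Functor.map_comp, biprod.inl_fst, CategoryTheory.Functor.map_id]
  exact IsIso.of_isIso_fac_left h

end StableIso

lemma isIso_neg {B : Type u} [Category.{v} B] [Preadditive B] {X Y : B} (f : X ⟶ Y) [IsIso f] :
    IsIso (-f) :=
  ⟨-inv f, by simp, by simp⟩

section CosyzygyIso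

variable {A : Type u} [Category.{v} A] [Abelian A] [HasExt.{w} A] {C : ObjectProperty A}

lemma SpecialPreenvelope.homToSurjective {N : A} (E : SpecialPreenvelope.{w} C N) :
    HomToSurjective C (ShortComplex.mk E.ι E.π E.ι_π) :=
  fun _ hZ f ↦ E.exists_extension hZ f

variable [C.IsClosedUnderFiniteProducts] (S : SpecialPreenvelopes.{w} C)

variable {S} in
lemma IsCosyzygyMap.cosyzygyFunctor_map {M N : A} {f : M ⟶ N} {b : (S M).cosyz ⟶ (S N).cosyz}
    (hb : IsCosyzygyMap (S M) (S N) f b) :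
    (cosyzygyFunctor S).map ((stableFunctor C).map f) = (stableFunctor C).map b :=
  (exists_isCosyzygyMap (S M) (S N) f).choose_spec.map_eq hb
    (by rw [sub_self]; exact FactorsThrough.zero _ _)

/-- The counterpart of "in a triangle with first term zero, the second map is invertible". Three
rotations turn the sequence, up to summands in `C`, into a proper sequence `ΣX ⟶ ΣY ⟶ ΣZ` whose
second map is `-Σp`, so induction on `k` applies. -/
theorem isIso_endoPow_cosyzygyFunctor_map (k : ℕ) {X Y Z : A} {f : X ⟶ Y} {p : Y ⟶ Z}
    {w : f ≫ p = 0} (hS : (ShortComplex.mk f p w).ShortExact)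
    (hS' : HomToSurjective C (ShortComplex.mk f p w))
    (hX : IsZero ((endoPow (cosyzygyFunctor S) k).obj ((stableFunctor C).obj X))) :
    IsIso ((endoPow (cosyzygyFunctor S) k).map ((stableFunctor C).map p)) := by
  induction k generalizing X Y Z with
  | zero =>
    change IsZero ((stableFunctor C).obj X) at hX
    change IsIso ((stableFunctor C).map p)
    have : Epi p := hS.epi_g
    rw [IsZero.iff_id_eq_zero, ← (stableFunctor C).map_id, stableFunctor_map_eq_zero_iff] at hX
    obtain ⟨J, hJ, g, h, hgh⟩ := hX
    obtain ⟨r, hr⟩ := hS' J hJ g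
    dsimp at r hr
    -- The identity of `X` factors through `J` and properness extends `X ⟶ J` to `Y`; the corrected
    -- identity of `Y` vanishes on `X` and descends to an inverse of `p` modulo `C`.
    obtain ⟨s, hs⟩ := exists_desc_of_shortExact hS (𝟙 Y - r ≫ h ≫ f) (by
      dsimp
      rw [Preadditive.comp_sub, ← Category.assoc f r, hr, ← Category.assoc, hgh]; simp)
    dsimp at s hs
    refine ⟨(stableFunctor C).map s, ?_, ?_⟩
    · rw [← Functor.map_comp, ← CategoryTheory.Functor.map_id, stableFunctor_map_eq_iff, hs]
      exact ⟨J, hJ, -r, h ≫ f, by simp⟩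
    · rw [← Functor.map_comp, ← CategoryTheory.Functor.map_id]
      congr 1
      rw [← cancel_epi p, ← Category.assoc, hs]
      simp [w]
  | succ k ih =>
    obtain ⟨e₁, he₁⟩ := hS' _ (S X).mem (S X).ι
    dsimp at e₁ he₁
    obtain ⟨c₁, hc₁⟩ := exists_desc_of_shortExact hS (e₁ ≫ (S X).π) (by
      dsimp; rw [← Category.assoc, he₁, (S X).ι_π])
    dsimp at c₁ hc₁
    have hS₁ := rotate_shortExact hS (S X).shortExact he₁ hc₁
    have hS₁' := rotate_homToSurjective hS (S X).homToSurjective he₁ hc₁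
    obtain ⟨e₂, he₂⟩ := hS₁' _ (S Y).mem (S Y).ι
    dsimp at e₂ he₂
    obtain ⟨c₂, hc₂⟩ := exists_desc_of_shortExact hS₁ (e₂ ≫ (S Y).π) (by
      dsimp; rw [← Category.assoc, he₂, (S Y).ι_π])
    dsimp at c₂ hc₂
    have hS₂ := rotate_shortExact hS₁ (S Y).shortExact he₂ hc₂
    have hS₂' := rotate_homToSurjective hS₁ (S Y).homToSurjective he₂ hc₂
    -- The third rotation starts at `Z ⊞ I_X`, which is embedded in `I_Z ⊞ I_X`, so that the
    -- cokernel is exactly `ΣZ`.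
    obtain ⟨e₃, he₃⟩ : ∃ e₃ : (S X).cosyz ⊞ (S Y).I ⟶ (S Z).I ⊞ (S X).I,
        biprod.lift (biprod.desc c₁ (-(S X).π)) e₂ ≫ e₃ = biprod.map (S Z).ι (𝟙 (S X).I) := by
      obtain ⟨g, hg⟩ := hS₂' _ (S Z).mem (biprod.fst ≫ (S Z).ι)
      obtain ⟨g', hg'⟩ := hS₂' _ (S X).mem biprod.snd
      dsimp at g hg g' hg'
      refine ⟨biprod.lift g g', ?_⟩
      apply biprod.hom_ext
      · simp [hg]
      · simp [hg']
    have hT := shortExact_biprod_map_id (S Z).shortExact (S X).I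
    have hT' := homToSurjective_biprod_map_id (S Z).homToSurjective (S X).I
    obtain ⟨c₃, hc₃⟩ := exists_desc_of_shortExact hS₂ (e₃ ≫ biprod.fst ≫ (S Z).π) (by
      dsimp; rw [← Category.assoc, he₃]; simp [(S Z).ι_π])
    dsimp at c₃ hc₃
    have hS₃ := rotate_shortExact hS₂ hT he₃ hc₃
    have hS₃' := rotate_homToSurjective hS₂ hT' he₃ hc₃
    -- The sign is that of the triple rotation of a triangle.
    have hb : IsCosyzygyMap (S Y) (S Z) p (-c₃) := by
      refine ⟨biprod.inr ≫ e₃ ≫ biprod.fst, ?_, ?_⟩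
      · have h : biprod.lift p e₁ ≫ biprod.lift (biprod.desc c₁ (-(S X).π)) e₂ =
            (S Y).ι ≫ biprod.inr := by
          apply biprod.hom_ext
          · simp [hc₁]
          · simp [he₂]
        rw [← reassoc_of% h, ← Category.assoc _ e₃, he₃]
        simp
      · have h := biprod.inr ≫= hc₃
        rw [biprod.inr_desc_assoc] at h
        simpa using h
    have := isIso_stableFunctor_map_inl (S X).cosyz (S Y).mem
    have := isIso_stableFunctor_map_inl (S Y).cosyz (J := (S Z).I ⊞ (S X).I)
      (C.prop_of_isLimit_binaryFan (BinaryBiproduct.isLimit _ _) (S Z).mem (S X).mem)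
    have := ih hS₃ hS₃' (IsZero.of_iso hX (asIso ((endoPow (cosyzygyFunctor S) k).map
      ((stableFunctor C).map (biprod.inl : _ ⟶ (S X).cosyz ⊞ (S Y).I)))).symm)
    change IsIso ((endoPow (cosyzygyFunctor S) k).map
      ((cosyzygyFunctor S).map ((stableFunctor C).map p)))
    have h : -c₃ = -((biprod.inl : _ ⟶ _ ⊞ ((S Z).I ⊞ (S X).I)) ≫
        biprod.desc c₃ (-(biprod.fst ≫ (S Z).π))) := by
      rw [biprod.inl_desc]
    have key : IsIso ((endoPow (cosyzygyFunctor S) k).map ((stableFunctor C).map (-c₃))) := by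
      rw [h, Functor.map_neg, Functor.map_neg, Functor.map_comp, Functor.map_comp]
      exact isIso_neg _
    rw [hb.cosyzygyFunctor_map]
    exact key

end CosyzygyIso

/-! ### Dual part: morphisms inverted by iterated syzygies. -/

section SyzygyIso

variable {A : Type u} [Category.{v} A] [Abelian A] [HasExt.{w} A] {D : ObjectProperty A}

lemma SpecialPrecover.homFromSurjective {N : A} (E : SpecialPrecover.{w} D N) :
    HomFromSurjective D (ShortComplex.mk E.ι E.π E.ι_π) :=
  fun _ hZ f ↦ E.exists_lifting hZ f

variable [D.IsClosedUnderFiniteProducts] (T : SpecialPrecovers.{w} D)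

variable {T} in
lemma IsSyzygyMap.syzygyFunctor_map {M N : A} {f : M ⟶ N} {b : (T M).syz ⟶ (T N).syz}
    (hb : IsSyzygyMap (T M) (T N) f b) :
    (syzygyFunctor T).map ((stableFunctor D).map f) = (stableFunctor D).map b :=
  (exists_isSyzygyMap (T M) (T N) f).choose_spec.map_eq hb
    (by rw [sub_self]; exact FactorsThrough.zero _ _)

/-- Three inverse rotations lead to `ΩX ⟶ ΩY ⟶ ΩZ` up to summands in `D`, with first map `-Ωf`. -/
theorem isIso_endoPow_syzygyFunctor_map (k : ℕ) {X Y Z : A} {f : X ⟶ Y} {p : Y ⟶ Z}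
    {w : f ≫ p = 0} (hS : (ShortComplex.mk f p w).ShortExact)
    (hS' : HomFromSurjective D (ShortComplex.mk f p w))
    (hZ : IsZero ((endoPow (syzygyFunctor T) k).obj ((stableFunctor D).obj Z))) :
    IsIso ((endoPow (syzygyFunctor T) k).map ((stableFunctor D).map f)) := by
  induction k generalizing X Y Z with
  | zero =>
    change IsZero ((stableFunctor D).obj Z) at hZ
    change IsIso ((stableFunctor D).map f)
    have : Mono f := hS.mono_f
    rw [IsZero.iff_id_eq_zero, ← (stableFunctor D).map_id, stableFunctor_map_eq_zero_iff] at hZ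
    obtain ⟨J, hJ, g, h, hgh⟩ := hZ
    obtain ⟨r, hr⟩ := hS' J hJ h
    dsimp at r hr
    obtain ⟨s, hs⟩ := exists_lift_of_shortExact hS (𝟙 Y - p ≫ g ≫ r) (by
      dsimp
      rw [Preadditive.sub_comp, Category.assoc, Category.assoc, hr, hgh]; simp)
    dsimp at s hs
    refine ⟨(stableFunctor D).map s, ?_, ?_⟩
    · rw [← Functor.map_comp, ← CategoryTheory.Functor.map_id]
      congr 1
      rw [← cancel_mono f, Category.assoc, hs]
      simp [reassoc_of% w]
    · rw [← Functor.map_comp, ← CategoryTheory.Functor.map_id, stableFunctor_map_eq_iff, hs]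
      exact ⟨J, hJ, p ≫ g, -r, by simp⟩
  | succ k ih =>
    obtain ⟨e₁, he₁⟩ := hS' _ (T Z).mem (T Z).π
    dsimp at e₁ he₁
    obtain ⟨c₁, hc₁⟩ := exists_lift_of_shortExact hS ((T Z).ι ≫ e₁) (by
      dsimp; rw [Category.assoc, he₁, (T Z).ι_π])
    dsimp at c₁ hc₁
    have hS₁ := inverse_rotate_shortExact hS (T Z).shortExact he₁ hc₁
    have hS₁' := inverse_rotate_homFromSurjective hS (T Z).homFromSurjective he₁ hc₁
    obtain ⟨e₂, he₂⟩ := hS₁' _ (T Y).mem (T Y).π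
    dsimp at e₂ he₂
    obtain ⟨c₂, hc₂⟩ := exists_lift_of_shortExact hS₁ ((T Y).ι ≫ e₂) (by
      dsimp; rw [Category.assoc, he₂, (T Y).ι_π])
    dsimp at c₂ hc₂
    have hS₂ := inverse_rotate_shortExact hS₁ (T Y).shortExact he₂ hc₂
    have hS₂' := inverse_rotate_homFromSurjective hS₁ (T Y).homFromSurjective he₂ hc₂
    obtain ⟨e₃, he₃⟩ : ∃ e₃ : (T X).P ⊞ (T Z).P ⟶ (T Z).syz ⊞ (T Y).P,
        e₃ ≫ biprod.desc (biprod.lift c₁ (-(T Z).ι)) e₂ = biprod.map (T X).π (𝟙 (T Z).P) := by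
      obtain ⟨g, hg⟩ := hS₂' _ (T X).mem ((T X).π ≫ biprod.inl)
      obtain ⟨g', hg'⟩ := hS₂' _ (T Z).mem biprod.inr
      dsimp at g hg g' hg'
      refine ⟨biprod.desc g g', ?_⟩
      apply biprod.hom_ext'
      · simp [hg]
      · simp [hg']
    have hT := shortExact_biprod_map_id_right (T X).shortExact (T Z).P
    have hT' := homFromSurjective_biprod_map_id (T X).homFromSurjective (T Z).P
    obtain ⟨c₃, hc₃⟩ := exists_lift_of_shortExact hS₂ (((T X).ι ≫ biprod.inl) ≫ e₃) (by
      dsimp; rw [Category.assoc, he₃]; simp [reassoc_of% (T X).ι_π])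
    dsimp at c₃ hc₃
    have hS₃ := inverse_rotate_shortExact hS₂ hT he₃ hc₃
    have hS₃' := inverse_rotate_homFromSurjective hS₂ hT' he₃ hc₃
    have hb : IsSyzygyMap (T X) (T Y) f (-c₃) := by
      refine ⟨biprod.inl ≫ e₃ ≫ biprod.snd, ?_, ?_⟩
      · have h : biprod.desc (biprod.lift c₁ (-(T Z).ι)) e₂ ≫ biprod.desc f e₁ =
            biprod.snd ≫ (T Y).π := by
          apply biprod.hom_ext'
          · simp [hc₁]
          · simp [he₂]
        rw [Category.assoc, Category.assoc, ← h, reassoc_of% he₃]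
        simp
      · have h := hc₃ =≫ biprod.snd
        simpa [neg_eq_iff_eq_neg] using h
    have := isIso_stableFunctor_map_fst (T Z).syz (T Y).mem
    have := isIso_stableFunctor_map_fst (T Y).syz (J := (T X).P ⊞ (T Z).P)
      (D.prop_of_isLimit_binaryFan (BinaryBiproduct.isLimit _ _) (T X).mem (T Z).mem)
    let i := asIso ((endoPow (syzygyFunctor T) k).map
      ((stableFunctor D).map (biprod.fst : (T Z).syz ⊞ (T Y).P ⟶ (T Z).syz)))
    have := ih hS₃ hS₃' (IsZero.of_iso hZ i)
    change IsIso ((endoPow (syzygyFunctor T) k).map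
      ((syzygyFunctor T).map ((stableFunctor D).map f)))
    have h : -c₃ = -(biprod.lift c₃ (-((T X).ι ≫ biprod.inl)) ≫
        (biprod.fst : _ ⊞ ((T X).P ⊞ (T Z).P) ⟶ _)) := by
      rw [biprod.lift_fst]
    have key : IsIso ((endoPow (syzygyFunctor T) k).map ((stableFunctor D).map (-c₃))) := by
      rw [h, Functor.map_neg, Functor.map_neg, Functor.map_comp, Functor.map_comp]
      exact isIso_neg _
    rw [hb.syzygyFunctor_map]
    exact key

end SyzygyIso

/-! ### Consequences of balancedness -/

section Balanced

variable {A : Type u} [Category.{v} A] [Abelian A] [HasExt.{w} A] {C D : ObjectProperty A}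

/-- Balancedness supplies one `Hom(D, -)`-exact proper coresolution. A special preenvelope is
comparable with its beginning up to homotopy, which transfers exactness to the chosen sequence. -/
lemma IsBalancedPair.homFromSurjective (hDC : IsBalancedPair D C) {N : A}
    (E : SpecialPreenvelope.{w} C N) : HomFromSurjective D (ShortComplex.mk E.ι E.π E.ι_π) := by
  intro X hX f
  dsimp at f ⊢
  obtain ⟨I, hI⟩ := hDC.exists_coresolution N
  have := I.mono
  have : Epi E.π := E.shortExact.epi_g
  obtain ⟨g, hg⟩ := E.exists_extension (I.mem 0) I.ι
  obtain ⟨h, hh⟩ := (I.proper _ E.mem).surjective E.ι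
  dsimp at hh
  obtain ⟨g', hg'⟩ := exists_desc_of_shortExact E.shortExact (g ≫ I.cocomplex.d 0 1) (by
    dsimp; rw [← Category.assoc, hg, I.ι_d])
  dsimp at g' hg'
  have hd : g' ≫ I.cocomplex.d 1 2 = 0 := by
    rw [← cancel_epi E.π, ← Category.assoc, hg']; simp
  obtain ⟨t, ht⟩ := ((hI X hX).exact_succ 0 (f ≫ g')).1 (by
    dsimp; rw [Category.assoc, hd, comp_zero])
  dsimp at ht
  obtain ⟨s, hs⟩ := exists_desc_of_shortExact E.shortExact (𝟙 E.I - g ≫ h) (by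
    dsimp; rw [Preadditive.comp_sub, ← Category.assoc, hg, hh]; simp)
  dsimp at s hs
  -- `t` lifts the image of `f` in `I¹`, `h` brings it back to the preenvelope, and `s` is the
  -- homotopy correcting `g ≫ h` to the identity.
  refine ⟨t ≫ h + f ≫ s, ?_⟩
  obtain ⟨W, q, _, y, hy⟩ := surjective_up_to_refinements_of_epi E.π f
  have hz : (q ≫ t - y ≫ g) ≫ I.cocomplex.d 0 1 = 0 := by
    rw [Preadditive.sub_comp, Category.assoc, Category.assoc, ht, ← hg', reassoc_of% hy, sub_self]
  have hx : I.exact_zero.lift _ hz ≫ I.ι = q ≫ t - y ≫ g := I.exact_zero.lift_f _ hz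
  have h1 : (q ≫ t - y ≫ g) ≫ h ≫ E.π = 0 := by
    rw [← hx, Category.assoc, reassoc_of% hh, E.ι_π, comp_zero]
  rw [Preadditive.sub_comp, sub_eq_zero] at h1
  simp only [Category.assoc] at h1
  rw [← cancel_epi q]
  simp only [Preadditive.add_comp, Preadditive.comp_add, Category.assoc]
  rw [h1, reassoc_of% hy, reassoc_of% hs]
  simp [hy]

lemma IsBalancedPair.homToSurjective (hDC : IsBalancedPair D C) {M : A}
    (E : SpecialPrecover.{w} D M) : HomToSurjective C (ShortComplex.mk E.ι E.π E.ι_π) := by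
  intro Z hZ f
  dsimp at f ⊢
  obtain ⟨P, hP⟩ := hDC.exists_resolution M
  have := P.epi
  have : Mono E.ι := E.shortExact.mono_f
  obtain ⟨g, hg⟩ := E.exists_lifting (P.mem 0) P.π
  obtain ⟨h, hh⟩ := (P.proper _ E.mem).surjective E.π
  dsimp at hh
  obtain ⟨g', hg'⟩ := exists_lift_of_shortExact E.shortExact (P.complex.d 1 0 ≫ g) (by
    dsimp; rw [Category.assoc, hg, P.d_π])
  dsimp at g' hg'
  have hd : P.complex.d 2 1 ≫ g' = 0 := by
    rw [← cancel_mono E.ι, Category.assoc, hg']; simp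
  obtain ⟨t, ht⟩ := ((hP Z hZ).exact_succ 0 (g' ≫ f)).1 (by
    dsimp; rw [← Category.assoc, hd, zero_comp])
  dsimp at ht
  obtain ⟨s, hs⟩ := exists_lift_of_shortExact E.shortExact (𝟙 E.P - h ≫ g) (by
    dsimp; rw [Preadditive.sub_comp, Category.assoc, hg, hh]; simp)
  dsimp at s hs
  refine ⟨h ≫ t + s ≫ f, ?_⟩
  obtain ⟨W, q, _, y, hy⟩ := P.exact_zero.exact_up_to_refinements (E.ι ≫ h) (by
    dsimp; rw [Category.assoc, hh, E.ι_π])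
  dsimp at y hy
  have h1 : q ≫ E.ι ≫ s = q - y ≫ g' := by
    rw [← cancel_mono E.ι]
    simp only [Category.assoc, Preadditive.sub_comp, hs, hg', Preadditive.comp_sub]
    rw [← reassoc_of% hy]
    simp
  rw [← cancel_epi q]
  simp only [Preadditive.comp_add]
  rw [reassoc_of% hy, ht, reassoc_of% h1]
  simp

end Balanced

/-! ### The unit `M ⟶ ΣΩM` and the counit `ΩΣN ⟶ N` -/

section UnitCounit

variable {A : Type u} [Category.{v} A] [Abelian A] [HasExt.{w} A] {C D : ObjectProperty A}

/-- `η : M ⟶ ΣΩM` is induced by an extension of `ΩM ⟶ I` to the special precover of `M`. -/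
def IsUnitMap {M : A} (E : SpecialPrecover.{w} D M) (E' : SpecialPreenvelope.{w} C E.syz)
    (η : M ⟶ E'.cosyz) : Prop :=
  ∃ a : E.P ⟶ E'.I, E.ι ≫ a = E'.ι ∧ E.π ≫ η = a ≫ E'.π

/-- `ε : ΩΣN ⟶ N` is induced by a lift of `P ⟶ ΣN` to the special preenvelope of `N`. -/
def IsCounitMap {N : A} (E : SpecialPreenvelope.{w} C N) (E' : SpecialPrecover.{w} D E.cosyz)
    (ε : E'.syz ⟶ N) : Prop :=
  ∃ a : E'.P ⟶ E.I, a ≫ E.π = E'.π ∧ ε ≫ E.ι = E'.ι ≫ a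

lemma IsBalancedPair.exists_isUnitMap (hDC : IsBalancedPair D C) {M : A}
    (E : SpecialPrecover.{w} D M) (E' : SpecialPreenvelope.{w} C E.syz) :
    ∃ η, IsUnitMap E E' η := by
  obtain ⟨a, ha⟩ := hDC.homToSurjective E _ E'.mem E'.ι
  dsimp at a ha
  obtain ⟨η, hη⟩ := exists_desc_of_shortExact E.shortExact (a ≫ E'.π) (by
    dsimp; rw [← Category.assoc, ha, E'.ι_π])
  exact ⟨η, a, ha, hη⟩

lemma IsBalancedPair.exists_isCounitMap (hDC : IsBalancedPair D C) {N : A}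
    (E : SpecialPreenvelope.{w} C N) (E' : SpecialPrecover.{w} D E.cosyz) :
    ∃ ε, IsCounitMap E E' ε := by
  obtain ⟨a, ha⟩ := hDC.homFromSurjective E _ E'.mem E'.π
  dsimp at a ha
  obtain ⟨ε, hε⟩ := exists_lift_of_shortExact E.shortExact (E'.ι ≫ a) (by
    dsimp; rw [Category.assoc, ha, E'.ι_π])
  exact ⟨ε, a, ha, hε⟩

/-- Naturality of the unit modulo `C`. The two composites `P ⟶ I` lying over the two sides agree on
`ΩM`, so their difference descends to a map from `M` to an object of `C`. -/
lemma IsUnitMap.factorsThrough {M N : A} {E : SpecialPrecover.{w} D M}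
    {F : SpecialPrecover.{w} D N} {E' : SpecialPreenvelope.{w} C E.syz}
    {F' : SpecialPreenvelope.{w} C F.syz} {η : M ⟶ E'.cosyz} {η' : N ⟶ F'.cosyz}
    (hη : IsUnitMap E E' η) (hη' : IsUnitMap F F' η') {f : M ⟶ N} {b : E.syz ⟶ F.syz}
    (hb : IsSyzygyMap E F f b) {c : E'.cosyz ⟶ F'.cosyz} (hc : IsCosyzygyMap E' F' b c) :
    FactorsThrough C (f ≫ η' - η ≫ c) := by
  obtain ⟨a, ha, haη⟩ := hη
  obtain ⟨a', ha', haη'⟩ := hη'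
  obtain ⟨p, hp, hpb⟩ := hb
  obtain ⟨q, hq, hqc⟩ := hc
  have : Epi E.π := E.shortExact.epi_g
  obtain ⟨t, ht⟩ := exists_desc_of_shortExact E.shortExact (p ≫ a' - a ≫ q) (by
    dsimp
    rw [Preadditive.comp_sub, ← Category.assoc, ← hpb, Category.assoc, ha', ← Category.assoc, ha,
      hq, sub_self])
  dsimp at t ht
  refine ⟨F'.I, F'.mem, t, F'.π, ?_⟩
  rw [← cancel_epi E.π, reassoc_of% ht]
  simp only [Preadditive.sub_comp, Preadditive.comp_sub, Category.assoc]
  rw [← haη', reassoc_of% hp, reassoc_of% haη, hqc]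

lemma IsCounitMap.factorsThrough {M N : A} {E : SpecialPreenvelope.{w} C M}
    {F : SpecialPreenvelope.{w} C N} {E' : SpecialPrecover.{w} D E.cosyz}
    {F' : SpecialPrecover.{w} D F.cosyz} {ε : E'.syz ⟶ M} {ε' : F'.syz ⟶ N}
    (hε : IsCounitMap E E' ε) (hε' : IsCounitMap F F' ε') {f : M ⟶ N} {c : E.cosyz ⟶ F.cosyz}
    (hc : IsCosyzygyMap E F f c) {b : E'.syz ⟶ F'.syz} (hb : IsSyzygyMap E' F' c b) :
    FactorsThrough D (b ≫ ε' - ε ≫ f) := by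
  obtain ⟨a, ha, haε⟩ := hε
  obtain ⟨a', ha', haε'⟩ := hε'
  obtain ⟨p, hp, hpc⟩ := hc
  obtain ⟨q, hq, hqb⟩ := hb
  have : Mono F.ι := F.shortExact.mono_f
  obtain ⟨t, ht⟩ := exists_lift_of_shortExact F.shortExact (q ≫ a' - a ≫ p) (by
    dsimp
    rw [Preadditive.sub_comp, Category.assoc, ha', hq, Category.assoc, ← hpc, reassoc_of% ha,
      sub_self])
  dsimp at t ht
  refine ⟨E'.P, E'.mem, E'.ι, t, ?_⟩
  rw [← cancel_mono F.ι, Category.assoc, ht]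
  simp only [Preadditive.sub_comp, Preadditive.comp_sub, Category.assoc]
  rw [haε', reassoc_of% hqb, ← hp, reassoc_of% haε]

/-- Rotating `ΩM ⟶ P ⟶ M` along the preenvelope of `ΩM` gives `P ⟶ M ⊞ I ⟶ ΣΩM`, whose second map is
the unit up to the summand `I` in `C`. -/
lemma IsUnitMap.isIso_endoPow_map [C.IsClosedUnderFiniteProducts]
    (S : SpecialPreenvelopes.{w} C) {M : A}
    {E : SpecialPrecover.{w} D M} {η : M ⟶ (S E.syz).cosyz} (hη : IsUnitMap E (S E.syz) η) {k : ℕ}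
    (hk : IsZero ((endoPow (cosyzygyFunctor S) k).obj ((stableFunctor C).obj E.P))) :
    IsIso ((endoPow (cosyzygyFunctor S) k).map ((stableFunctor C).map η)) := by
  obtain ⟨a, ha, haη⟩ := hη
  have := isIso_endoPow_cosyzygyFunctor_map S k
    (rotate_shortExact E.shortExact (S E.syz).shortExact ha haη)
    (rotate_homToSurjective E.shortExact (S E.syz).homToSurjective ha haη) hk
  have := isIso_stableFunctor_map_inl M (S E.syz).mem
  rw [show η = biprod.inl ≫ biprod.desc η (-(S E.syz).π) by simp, Functor.map_comp,
    Functor.map_comp]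
  infer_instance

lemma IsCounitMap.isIso_endoPow_map [D.IsClosedUnderFiniteProducts]
    (T : SpecialPrecovers.{w} D) {N : A}
    {E : SpecialPreenvelope.{w} C N} {ε : (T E.cosyz).syz ⟶ N} (hε : IsCounitMap E (T E.cosyz) ε)
    {k : ℕ} (hk : IsZero ((endoPow (syzygyFunctor T) k).obj ((stableFunctor D).obj E.I))) :
    IsIso ((endoPow (syzygyFunctor T) k).map ((stableFunctor D).map ε)) := by
  obtain ⟨a, ha, haε⟩ := hε
  have := isIso_endoPow_syzygyFunctor_map T k
    (inverse_rotate_shortExact E.shortExact (T E.cosyz).shortExact ha haε)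
    (inverse_rotate_homFromSurjective E.shortExact (T E.cosyz).homFromSurjective ha haε) hk
  have := isIso_stableFunctor_map_fst N (T E.cosyz).mem
  rw [show ε = biprod.lift ε (-(T E.cosyz).ι) ≫ biprod.fst by simp, Functor.map_comp,
    Functor.map_comp]
  infer_instance

end UnitCounit

/-! ### Objects annihilated by an iterate of an endofunctor of the stable category -/

section EventuallyZero

variable {A : Type u} [Category.{v} A] [Abelian A] {P : ObjectProperty A}
  [P.IsClosedUnderFiniteProducts] (F : StableCategory P ⥤ StableCategory P)

/-- The objects that become zero in the stable category after some iteration of `F`. -/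
def eventuallyZero : ObjectProperty A :=
  fun X ↦ ∃ k, IsZero ((endoPow F k).obj ((stableFunctor P).obj X))

variable {F} [F.Additive]

lemma isZero_endoPow_obj_of_le {k l : ℕ} (hkl : k ≤ l) {X : StableCategory P}
    (h : IsZero ((endoPow F k).obj X)) : IsZero ((endoPow F l).obj X) := by
  induction l, hkl using Nat.le_induction with
  | base => exact h
  | succ l _ ih =>
    rw [endoPow_succ']
    exact F.map_isZero ih

instance : (eventuallyZero F).IsClosedUnderFiniteProducts where
  isClosedUnderLimitsOfShape J _ :=
    { limitsOfShape_le := by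
        rintro X ⟨p⟩
        have := Fintype.ofFinite J
        choose k hk using fun j : Discrete J ↦ p.prop_diag_obj j
        let l := Finset.univ.sup fun j : J ↦ k ⟨j⟩
        let G := stableFunctor P ⋙ endoPow F l
        have : PreservesFiniteProducts G := inferInstance
        refine ⟨l, ?_⟩
        rw [IsZero.iff_id_eq_zero]
        refine (isLimitOfPreserves G p.isLimit).hom_ext fun j ↦ ?_
        exact (isZero_endoPow_obj_of_le (Finset.le_sup (f := fun j : J ↦ k ⟨j⟩)
          (Finset.mem_univ j.as)) (hk j)).eq_of_tgt _ _ }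

omit [F.Additive] in
lemma eventuallyZero_of_mem {X : A} (hX : P X) : eventuallyZero F X :=
  ⟨0, isZero_stableFunctor_obj hX⟩

end EventuallyZero

/-! ### Finite relative projective dimension -/

section ProjDim

variable {A : Type u} [Category.{v} A] [Abelian A] [HasExt.{w} A] {D : ObjectProperty A}

omit [HasExt.{w} A] in
lemma shortExact_kernel_ι_kernel_lift {X Y Z : A} {f : X ⟶ Y} {g : Y ⟶ Z} {w : f ≫ g = 0}
    (h : (ShortComplex.mk f g w).Exact) :
    (ShortComplex.mk (kernel.ι f) (kernel.lift g f w) (by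
      rw [← cancel_mono (kernel.ι g)]; simp)).ShortExact := by
  refine ShortComplex.ShortExact.mk' ?_ (by dsimp; infer_instance) ?_
  · rw [ShortComplex.exact_iff_exact_up_to_refinements]
    intro W u hu
    dsimp at u hu
    exact ⟨W, 𝟙 W, inferInstance, kernel.lift f u (by
      simpa using hu =≫ kernel.ι g), by simp⟩
  · exact (ShortComplex.exact_iff_epi_kernel_lift _).1 h

variable [D.IsClosedUnderFiniteProducts] (T : SpecialPrecovers.{w} D)

/-- A form of Schanuel's lemma: as `Y` is stably zero, the inverse rotation `ΩZ ⟶ X ⊞ P ⟶ Y` makes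
`X` and `ΩZ` stably isomorphic, at the cost of one more iterate. -/
lemma eventuallyZero_syzygyFunctor_of_shortExact {X Y Z : A} {f : X ⟶ Y} {p : Y ⟶ Z}
    {w : f ≫ p = 0} (hS : (ShortComplex.mk f p w).ShortExact)
    (hS' : HomFromSurjective D (ShortComplex.mk f p w)) (hY : D Y)
    (hX : eventuallyZero (syzygyFunctor T) X) : eventuallyZero (syzygyFunctor T) Z := by
  obtain ⟨k, hk⟩ := hX
  obtain ⟨e, he⟩ := hS' _ (T Z).mem (T Z).π
  dsimp at e he
  obtain ⟨c, hc⟩ := exists_lift_of_shortExact hS ((T Z).ι ≫ e) (by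
    dsimp; rw [Category.assoc, he, (T Z).ι_π])
  dsimp at c hc
  have : IsIso ((stableFunctor D).map (biprod.lift c (-(T Z).ι))) :=
    isIso_endoPow_syzygyFunctor_map T 0
      (inverse_rotate_shortExact hS (T Z).shortExact he hc)
      (inverse_rotate_homFromSurjective hS (T Z).homFromSurjective he hc)
      (isZero_stableFunctor_obj hY)
  have := isIso_stableFunctor_map_fst X (T Z).mem
  let i : (stableFunctor D).obj (T Z).syz ≅ (stableFunctor D).obj X :=
    asIso ((stableFunctor D).map (biprod.lift c (-(T Z).ι))) ≪≫
      asIso ((stableFunctor D).map biprod.fst)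
  exact ⟨k + 1, IsZero.of_iso hk ((endoPow (syzygyFunctor T) k).mapIso i)⟩

omit [HasExt.{w} A] [D.IsClosedUnderFiniteProducts] in
lemma homFromSurjective_kernel_lift {X Y Z : A} {f : X ⟶ Y} {g : Y ⟶ Z} {w : f ≫ g = 0}
    (h : ∀ J : A, D J → Function.Exact (fun x : J ⟶ X ↦ x ≫ f) (fun x : J ⟶ Y ↦ x ≫ g)) :
    HomFromSurjective D (ShortComplex.mk (kernel.ι f) (kernel.lift g f w) (by
      rw [← cancel_mono (kernel.ι g)]; simp)) := by
  intro J hJ x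
  obtain ⟨y, hy⟩ := (h J hJ (x ≫ kernel.ι g)).1 (by simp)
  exact ⟨y, by rw [← cancel_mono (kernel.ι g)]; simpa using hy⟩

lemma ProperResolution.eventuallyZero {M : A} (P : ProperResolution D M) {n : ℕ}
    (hn : ∀ m, n ≤ m → IsZero (P.complex.X m)) : eventuallyZero (syzygyFunctor T) M := by
  -- Induction from the vanishing tail towards degree zero, through the kernels of the
  -- differentials.
  have key (n : ℕ) : ∀ j, (∀ m, j + n ≤ m → IsZero (P.complex.X m)) →
      RelativeCohomology.eventuallyZero (syzygyFunctor T) (kernel (P.complex.d (j + 1) j)) := by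
    induction n with
    | zero =>
      intro j hj
      refine ⟨0, (stableFunctor D).map_isZero (IsZero.of_mono (kernel.ι _) (hj (j + 1) ?_))⟩
      lia
    | succ n ih =>
      intro j hj
      exact eventuallyZero_syzygyFunctor_of_shortExact T
        (shortExact_kernel_ι_kernel_lift (P.exact_succ j))
        (homFromSurjective_kernel_lift fun J hJ ↦ (P.proper J hJ).exact_succ j)
        (P.mem (j + 2)) (ih (j + 1) fun m hm ↦ hj m (by lia))
  have h₁ := eventuallyZero_syzygyFunctor_of_shortExact T
    (shortExact_kernel_ι_kernel_lift P.exact_zero)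
    (homFromSurjective_kernel_lift fun J hJ ↦ (P.proper J hJ).exact_zero)
    (P.mem 1) (key n 0 fun m hm ↦ hn m (by lia))
  have := P.epi
  refine eventuallyZero_syzygyFunctor_of_shortExact T (f := kernel.ι P.π) (p := P.π)
    (w := kernel.condition _) ?_ (fun J hJ x ↦ (P.proper J hJ).surjective x) (P.mem 0) h₁
  exact ShortComplex.ShortExact.mk' (ShortComplex.exact_kernel P.π) (by dsimp; infer_instance)
    P.epi

lemma exists_forall_le_of_iSup_lt_top {p : ℕ → Prop}
    (h : ⨆ (n : ℕ) (_ : p n), (n : WithBot ℕ∞) < ⊤) : ∃ n, ∀ m, n ≤ m → ¬ p m := by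
  obtain ⟨b, hb⟩ : ∃ b : ℕ, ∀ n, p n → n ≤ b := by
    have hle : ∀ n, p n → (n : WithBot ℕ∞) ≤ ⨆ (n : ℕ) (_ : p n), (n : WithBot ℕ∞) :=
      fun n hn ↦ le_iSup₂_of_le n hn le_rfl
    -- The supremum is `⊥` when no index satisfies `p`; any bound then works.
    generalize (⨆ (n : ℕ) (_ : p n), (n : WithBot ℕ∞)) = x at h hle
    obtain _ | _ | b := x
    · exact ⟨0, fun n hn ↦ absurd (hle n hn) (WithBot.not_coe_le_bot _)⟩
    · exact absurd h (lt_irrefl _)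
    · exact ⟨b, fun n hn ↦ Nat.cast_le.1 (WithBot.coe_le_coe.1 (hle n hn) : (n : ℕ∞) ≤ (b : ℕ))⟩
  exact ⟨b + 1, fun m hm hp ↦ by have := hb m hp; lia⟩

lemma eventuallyZero_of_relProjDim_lt_top {M : A} (h : relProjDim D M < ⊤) :
    eventuallyZero (syzygyFunctor T) M := by
  obtain ⟨P, hP⟩ := iInf_lt_iff.1 h
  obtain ⟨n, hn⟩ := exists_forall_le_of_iSup_lt_top hP
  exact P.eventuallyZero T fun m hm ↦ not_not.1 (hn m hm)

/-! ### Splicing and trimming: from vanishing syzygies to a finite proper resolution. -/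

omit [HasExt.{w} A] in
lemma exact_comp_comp {X K Y L Z : A} {p : X ⟶ K} {i : K ⟶ Y} {q : Y ⟶ L} {m : L ⟶ Z}
    [Epi p] [Mono m] {w : i ≫ q = 0} (h : (ShortComplex.mk i q w).Exact) :
    (ShortComplex.mk (p ≫ i) (q ≫ m) (by simp [reassoc_of% w])).Exact := by
  refine (ShortComplex.exact_iff_of_epi_of_isIso_of_mono
    (φ := ({ τ₁ := p, τ₂ := 𝟙 Y, τ₃ := 𝟙 Z } :
      ShortComplex.mk (p ≫ i) (q ≫ m) (by simp [reassoc_of% w]) ⟶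
        ShortComplex.mk i (q ≫ m) (by simp [reassoc_of% w])))).2 ?_
  exact (ShortComplex.exact_iff_of_epi_of_isIso_of_mono
    (φ := ({ τ₁ := 𝟙 K, τ₂ := 𝟙 Y, τ₃ := m } :
      ShortComplex.mk i q w ⟶ ShortComplex.mk i (q ≫ m) (by simp [reassoc_of% w])))).1 h

omit [HasExt.{w} A] [Abelian A] in
lemma function_exact_comp_comp [HasZeroMorphisms A] {X K Y L Z : A} {p : X ⟶ K}
    {i : K ⟶ Y} {q : Y ⟶ L} {m : L ⟶ Z} [Mono m] {w : i ≫ q = 0} {J : A} (h : ∀ x : J ⟶ Y, x ≫ q = 0 → ∃ y : J ⟶ K, y ≫ i = x)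
    (hp : ∀ y : J ⟶ K, ∃ z : J ⟶ X, z ≫ p = y) :
    Function.Exact (fun x : J ⟶ X ↦ x ≫ p ≫ i) (fun x : J ⟶ Y ↦ x ≫ q ≫ m) := by
  refine fun x ↦ ⟨fun hx ↦ ?_, ?_⟩
  · obtain ⟨y, rfl⟩ := h x (by rw [← cancel_mono m]; simpa using hx)
    obtain ⟨z, rfl⟩ := hp y
    exact ⟨z, by simp⟩
  · rintro ⟨z, rfl⟩
    simp [reassoc_of% w]

section SplicedResolution

variable {Z P : ℕ → A} (ι : ∀ j, Z (j + 1) ⟶ P j) (π : ∀ j, P j ⟶ Z j) (w : ∀ j, ι j ≫ π j = 0)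

/-- The complex with differentials `π (j + 1) ≫ ι j`. -/
def spliceComplex : ChainComplex A ℕ :=
  ChainComplex.of P (fun j ↦ π (j + 1) ≫ ι j) fun j ↦ by
    simp [reassoc_of% (w (j + 1))]

omit [HasExt.{w} A] in
lemma spliceComplex_d (j : ℕ) : (spliceComplex ι π w).d (j + 1) j = π (j + 1) ≫ ι j :=
  ChainComplex.of_d P (fun j ↦ π (j + 1) ≫ ι j) j

/-- The proper resolution obtained by splicing short exact sequences. -/
def spliceResolution (hS : ∀ j, (ShortComplex.mk (ι j) (π j) (w j)).ShortExact)
    (hS' : ∀ j, HomFromSurjective D (ShortComplex.mk (ι j) (π j) (w j))) (hP : ∀ j, D (P j)) :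
    ProperResolution D (Z 0) where
  complex := spliceComplex ι π w
  π := π 0
  d_π := by
    have h : (π 1 ≫ ι 0) ≫ π 0 = 0 := by rw [Category.assoc, w, comp_zero]
    rw [spliceComplex_d]
    exact h
  epi := (hS 0).epi_g
  exact_zero := by
    have := (hS 1).epi_g
    have h := exact_comp_comp (p := π 1) (m := 𝟙 _) (hS 0).exact
    simp only [spliceComplex_d]
    simp only [Category.comp_id] at h
    exact h
  exact_succ n := by
    have := (hS (n + 2)).epi_g
    have := (hS n).mono_f
    simp only [spliceComplex_d]
    exact exact_comp_comp (p := π (n + 2)) (m := ι n) (hS (n + 1)).exact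
  mem := hP
  proper J hJ :=
    { surjective := hS' 0 J hJ
      exact_zero := by
        have h := function_exact_comp_comp (m := 𝟙 _) (w := w 0)
          (exists_lift_of_shortExact (hS 0)) (hS' 1 J hJ)
        simp only [spliceComplex_d]
        simp only [Category.comp_id] at h
        exact h
      exact_succ n := by
        have := (hS n).mono_f
        simp only [spliceComplex_d]
        exact function_exact_comp_comp (m := ι n) (w := w (n + 1))
          (exists_lift_of_shortExact (hS (n + 1))) (hS' (n + 2) J hJ) }

end SplicedResolution

omit [D.IsClosedUnderFiniteProducts] in
lemma leftPerp_isZero (C : ObjectProperty A) {X : A} (hX : IsZero X) : leftPerp.{w} C X :=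
  fun _ _ ↦ ⟨fun x y ↦ by
    rw [← Abelian.Ext.mk₀_id_comp x, ← Abelian.Ext.mk₀_id_comp y, hX.eq_of_src (𝟙 X) 0,
      Abelian.Ext.mk₀_zero, Abelian.Ext.zero_comp, Abelian.Ext.zero_comp]⟩

omit [D.IsClosedUnderFiniteProducts] in
lemma rightPerp_isZero (D : ObjectProperty A) {X : A} (hX : IsZero X) : rightPerp.{w} D X :=
  fun _ _ ↦ ⟨fun x y ↦ by
    rw [← Abelian.Ext.comp_mk₀_id x, ← Abelian.Ext.comp_mk₀_id y, hX.eq_of_src (𝟙 X) 0,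
      Abelian.Ext.mk₀_zero, Abelian.Ext.comp_zero, Abelian.Ext.comp_zero]⟩

open Classical ZeroObject in
/-- The special precovers of `T`, replaced by the identity for the objects of `D`. -/
def trimPrecovers {D : ObjectProperty A} (T : SpecialPrecovers.{w} D) : SpecialPrecovers.{w} D :=
  fun M ↦ if h : D M then
    { P := M
      syz := 0
      ι := 0
      π := 𝟙 M
      ι_π := zero_comp
      shortExact := ShortComplex.ShortExact.mk'
        ((ShortComplex.exact_iff_mono _ rfl).2 inferInstance)
        ⟨fun _ _ _ ↦ (isZero_zero A).eq_of_tgt _ _⟩ inferInstance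
      mem := h
      syz_mem := rightPerp_isZero D (isZero_zero A) }
  else T M

/-- The iterated syzygies with respect to a choice of special precovers. -/
def iterSyzygy {D : ObjectProperty A} (T : SpecialPrecovers.{w} D) (M : A) : ℕ → A
  | 0 => M
  | j + 1 => (T (iterSyzygy T M j)).syz

omit [D.IsClosedUnderFiniteProducts] in
lemma iterSyzygy_syz (M : A) (j : ℕ) : iterSyzygy T (T M).syz j = iterSyzygy T M (j + 1) := by
  induction j with
  | zero => rfl
  | succ j ih => exact congrArg (fun X ↦ (T X).syz) ih

omit [D.IsClosedUnderFiniteProducts] in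
lemma isZero_trimPrecovers_syz {M : A} (hM : D M) : IsZero (trimPrecovers T M).syz := by
  rw [trimPrecovers, dif_pos hM]
  exact isZero_zero A

omit [D.IsClosedUnderFiniteProducts] in
lemma isZero_trimPrecovers_P {M : A} (hM : IsZero M) (hM' : D M) :
    IsZero (trimPrecovers T M).P := by
  rwa [trimPrecovers, dif_pos hM']

/-- The dimension counts nonzero terms, whereas an arbitrary special precover of an object of `D`
may have a nonzero syzygy in `D`. With the trimmed choice, once a syzygy lies in `D` all later ones
are zero objects. -/
lemma isZero_iterSyzygy_trimPrecovers [D.IsStableUnderRetracts] {M : A} {k : ℕ}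
    (h : IsZero ((endoPow (syzygyFunctor T) k).obj ((stableFunctor D).obj M))) {j : ℕ}
    (hj : k < j) : IsZero (iterSyzygy (trimPrecovers T) M j) := by
  have hD (X : A) (hX : IsZero X) : D X :=
    isZero_stableFunctor_obj_iff.1 ((stableFunctor D).map_isZero hX)
  induction j, hj using Nat.le_induction with
  | base =>
    induction k generalizing M with
    | zero => exact isZero_trimPrecovers_syz T (isZero_stableFunctor_obj_iff.1 h)
    | succ k ih =>
      rw [← iterSyzygy_syz]
      by_cases hM : D M
      · exact ih (Functor.map_isZero _ ((stableFunctor D).map_isZero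
          (isZero_trimPrecovers_syz T hM)))
      · refine ih ?_
        rw [trimPrecovers, dif_neg hM]
        exact h
  | succ j _ ih => exact isZero_trimPrecovers_syz T (hD _ ih)

lemma iSup_lt_top_of_forall_le {p : ℕ → Prop} {n : ℕ} (h : ∀ m, n ≤ m → ¬ p m) :
    ⨆ (n : ℕ) (_ : p n), (n : WithBot ℕ∞) < ⊤ := by
  refine lt_of_le_of_lt (b := ((n : ℕ∞) : WithBot ℕ∞)) (iSup₂_le fun m hm ↦ ?_) ?_
  · exact WithBot.coe_le_coe.2 (Nat.cast_le.2 (not_lt.1 fun hn ↦ h m hn.le hm))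
  · exact WithBot.coe_lt_coe.2 (ENat.natCast_lt_top n)

/-- For the converse the trimmed precovers are spliced; the term in degree `j` is zero as soon as
the `j`-th syzygy is. -/
theorem relProjDim_lt_top_iff [D.IsStableUnderRetracts] {M : A} :
    relProjDim D M < ⊤ ↔ eventuallyZero (syzygyFunctor T) M := by
  refine ⟨eventuallyZero_of_relProjDim_lt_top T, ?_⟩
  rintro ⟨k, hk⟩
  have hz (j : ℕ) (hj : k + 1 ≤ j) := isZero_iterSyzygy_trimPrecovers T hk hj
  let T' := trimPrecovers T
  refine lt_of_le_of_lt (iInf_le _ (spliceResolution (D := D) (Z := iterSyzygy T' M)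
    (fun j ↦ (T' (iterSyzygy T' M j)).ι) (fun j ↦ (T' (iterSyzygy T' M j)).π)
    (fun j ↦ (T' (iterSyzygy T' M j)).ι_π) (fun j ↦ (T' (iterSyzygy T' M j)).shortExact)
    (fun j ↦ (T' (iterSyzygy T' M j)).homFromSurjective)
    (fun j ↦ (T' (iterSyzygy T' M j)).mem))) ?_
  refine iSup_lt_top_of_forall_le (n := k + 1) fun j hj h ↦ h ?_
  exact isZero_trimPrecovers_P T (hz j hj)
    (isZero_stableFunctor_obj_iff.1 ((stableFunctor D).map_isZero (hz j hj)))

end ProjDim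

/-! ### Finite relative injective dimension -/

section InjDim

variable {A : Type u} [Category.{v} A] [Abelian A] {C : ObjectProperty A}

lemma shortExact_cokernel_desc_cokernel_π {X Y Z : A} {f : X ⟶ Y} {g : Y ⟶ Z} {w : f ≫ g = 0}
    (h : (ShortComplex.mk f g w).Exact) :
    (ShortComplex.mk (cokernel.desc f g w) (cokernel.π g) (by
      rw [← cancel_epi (cokernel.π f)]; simp)).ShortExact := by
  refine ShortComplex.ShortExact.mk' ?_ ?_ (by dsimp; infer_instance)
  · refine (ShortComplex.exact_iff_of_epi_of_isIso_of_mono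
      (φ := ({ τ₁ := cokernel.π f, τ₂ := 𝟙 Z, τ₃ := 𝟙 _ } :
        ShortComplex.mk g (cokernel.π g) (by simp) ⟶
          ShortComplex.mk (cokernel.desc f g w) (cokernel.π g) (by
            rw [← cancel_epi (cokernel.π f)]; simp)))).1 ?_
    exact ShortComplex.exact_cokernel g
  · exact (ShortComplex.exact_iff_mono_cokernel_desc _).1 h

lemma homToSurjective_cokernel_desc {X Y Z : A} {f : X ⟶ Y} {g : Y ⟶ Z} {w : f ≫ g = 0}
    (h : ∀ J : A, C J → Function.Exact (fun x : Z ⟶ J ↦ g ≫ x) (fun x : Y ⟶ J ↦ f ≫ x)) :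
    HomToSurjective C (ShortComplex.mk (cokernel.desc f g w) (cokernel.π g) (by
      rw [← cancel_epi (cokernel.π f)]; simp)) := by
  intro J hJ x
  obtain ⟨y, hy⟩ := (h J hJ (cokernel.π f ≫ x)).1 (by simp)
  exact ⟨y, by rw [← cancel_epi (cokernel.π f)]; simpa using hy⟩

/-! ### Splicing and trimming: from vanishing cosyzygies to a finite proper coresolution. -/

lemma function_exact_comp_comp_op {X K Y L Z : A} {p : X ⟶ K} {i : K ⟶ Y} {q : Y ⟶ L}
    {m : L ⟶ Z} [Epi p] {w : i ≫ q = 0} {J : A}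
    (h : ∀ x : Y ⟶ J, i ≫ x = 0 → ∃ y : L ⟶ J, q ≫ y = x)
    (hm : ∀ y : L ⟶ J, ∃ z : Z ⟶ J, m ≫ z = y) :
    Function.Exact (fun x : Z ⟶ J ↦ (q ≫ m) ≫ x) (fun x : Y ⟶ J ↦ (p ≫ i) ≫ x) := by
  refine fun x ↦ ⟨fun hx ↦ ?_, ?_⟩
  · obtain ⟨y, rfl⟩ := h x (by rw [← cancel_epi p]; simpa using hx)
    obtain ⟨z, rfl⟩ := hm y
    exact ⟨z, by simp⟩
  · rintro ⟨z, rfl⟩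
    simp [reassoc_of% w]

section SplicedCoresolution

variable {Z I : ℕ → A} (ι : ∀ j, Z j ⟶ I j) (π : ∀ j, I j ⟶ Z (j + 1)) (w : ∀ j, ι j ≫ π j = 0)

/-- The complex with differentials `π j ≫ ι (j + 1)`. -/
def spliceCocomplex : CochainComplex A ℕ :=
  CochainComplex.of I (fun j ↦ π j ≫ ι (j + 1)) fun j ↦ by
    simp [reassoc_of% (w (j + 1))]

lemma spliceCocomplex_d (j : ℕ) : (spliceCocomplex ι π w).d j (j + 1) = π j ≫ ι (j + 1) :=
  CochainComplex.of_d I (fun j ↦ π j ≫ ι (j + 1)) j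

/-- The proper coresolution obtained by splicing short exact sequences. -/
def spliceCoresolution (hS : ∀ j, (ShortComplex.mk (ι j) (π j) (w j)).ShortExact)
    (hS' : ∀ j, HomToSurjective C (ShortComplex.mk (ι j) (π j) (w j))) (hI : ∀ j, C (I j)) :
    ProperCoresolution C (Z 0) where
  cocomplex := spliceCocomplex ι π w
  ι := ι 0
  ι_d := by
    have h : ι 0 ≫ π 0 ≫ ι 1 = 0 := by rw [← Category.assoc, w, zero_comp]
    rw [spliceCocomplex_d]
    exact h
  mono := (hS 0).mono_f
  exact_zero := by
    have := (hS 1).mono_f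
    have h := exact_comp_comp (p := 𝟙 _) (m := ι 1) (hS 0).exact
    simp only [spliceCocomplex_d]
    simp only [Category.id_comp] at h
    exact h
  exact_succ n := by
    have := (hS n).epi_g
    have := (hS (n + 2)).mono_f
    simp only [spliceCocomplex_d]
    exact exact_comp_comp (p := π n) (m := ι (n + 2)) (hS (n + 1)).exact
  mem := hI
  proper J hJ :=
    { surjective := hS' 0 J hJ
      exact_zero := by
        have h := function_exact_comp_comp_op (p := 𝟙 _) (w := w 0)
          (exists_desc_of_shortExact (hS 0)) (hS' 1 J hJ)
        simp only [spliceCocomplex_d]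
        simp only [Category.id_comp] at h
        exact h
      exact_succ n := by
        have := (hS n).epi_g
        simp only [spliceCocomplex_d]
        exact function_exact_comp_comp_op (p := π n) (w := w (n + 1))
          (exists_desc_of_shortExact (hS (n + 1))) (hS' (n + 2) J hJ) }

end SplicedCoresolution

variable [HasExt.{w} A] (S : SpecialPreenvelopes.{w} C)

open Classical ZeroObject in
/-- The special preenvelopes of `S`, replaced by the identity for the objects of `C`. -/
def trimPreenvelopes {C : ObjectProperty A} (S : SpecialPreenvelopes.{w} C) :
    SpecialPreenvelopes.{w} C :=
  fun M ↦ if h : C M then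
    { I := M
      cosyz := 0
      ι := 𝟙 M
      π := 0
      ι_π := comp_zero
      shortExact := ShortComplex.ShortExact.mk'
        ((ShortComplex.exact_iff_epi _ rfl).2 inferInstance)
        inferInstance ⟨fun _ _ _ ↦ (isZero_zero A).eq_of_src _ _⟩
      mem := h
      cosyz_mem := leftPerp_isZero C (isZero_zero A) }
  else S M

/-- The iterated cosyzygies with respect to a choice of special preenvelopes. -/
def iterCosyzygy {C : ObjectProperty A} (S : SpecialPreenvelopes.{w} C) (M : A) : ℕ → A
  | 0 => M
  | j + 1 => (S (iterCosyzygy S M j)).cosyz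

lemma iterCosyzygy_cosyz (M : A) (j : ℕ) :
    iterCosyzygy S (S M).cosyz j = iterCosyzygy S M (j + 1) := by
  induction j with
  | zero => rfl
  | succ j ih => exact congrArg (fun X ↦ (S X).cosyz) ih

lemma isZero_trimPreenvelopes_cosyz {M : A} (hM : C M) :
    IsZero (trimPreenvelopes S M).cosyz := by
  rw [trimPreenvelopes, dif_pos hM]
  exact isZero_zero A

lemma isZero_trimPreenvelopes_I {M : A} (hM : IsZero M) (hM' : C M) :
    IsZero (trimPreenvelopes S M).I := by
  rwa [trimPreenvelopes, dif_pos hM']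

variable [C.IsClosedUnderFiniteProducts]

/-- Dual Schanuel argument: rotation makes `Z` and `ΣX` isomorphic modulo `C`. -/
lemma eventuallyZero_cosyzygyFunctor_of_shortExact {X Y Z : A} {f : X ⟶ Y} {p : Y ⟶ Z}
    {w : f ≫ p = 0} (hS : (ShortComplex.mk f p w).ShortExact)
    (hS' : HomToSurjective C (ShortComplex.mk f p w)) (hY : C Y)
    (hZ : eventuallyZero (cosyzygyFunctor S) Z) : eventuallyZero (cosyzygyFunctor S) X := by
  obtain ⟨k, hk⟩ := hZ
  obtain ⟨e, he⟩ := hS' _ (S X).mem (S X).ι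
  dsimp at e he
  obtain ⟨c, hc⟩ := exists_desc_of_shortExact hS (e ≫ (S X).π) (by
    dsimp; rw [← Category.assoc, he, (S X).ι_π])
  dsimp at c hc
  have : IsIso ((stableFunctor C).map (biprod.desc c (-(S X).π))) :=
    isIso_endoPow_cosyzygyFunctor_map S 0
      (rotate_shortExact hS (S X).shortExact he hc)
      (rotate_homToSurjective hS (S X).homToSurjective he hc)
      (isZero_stableFunctor_obj hY)
  have := isIso_stableFunctor_map_inl Z (S X).mem
  let i : (stableFunctor C).obj Z ≅ (stableFunctor C).obj (S X).cosyz :=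
    asIso ((stableFunctor C).map biprod.inl) ≪≫
      asIso ((stableFunctor C).map (biprod.desc c (-(S X).π)))
  exact ⟨k + 1, IsZero.of_iso hk ((endoPow (cosyzygyFunctor S) k).mapIso i.symm)⟩

lemma ProperCoresolution.eventuallyZero {M : A} (I : ProperCoresolution C M) {n : ℕ}
    (hn : ∀ m, n ≤ m → IsZero (I.cocomplex.X m)) : eventuallyZero (cosyzygyFunctor S) M := by
  have key (n : ℕ) : ∀ j, (∀ m, j + n ≤ m → IsZero (I.cocomplex.X m)) →
      RelativeCohomology.eventuallyZero (cosyzygyFunctor S)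
        (cokernel (I.cocomplex.d j (j + 1))) := by
    induction n with
    | zero =>
      intro j hj
      refine ⟨0, (stableFunctor C).map_isZero (IsZero.of_epi (cokernel.π _) (hj (j + 1) ?_))⟩
      lia
    | succ n ih =>
      intro j hj
      exact eventuallyZero_cosyzygyFunctor_of_shortExact S
        (shortExact_cokernel_desc_cokernel_π (I.exact_succ j))
        (homToSurjective_cokernel_desc fun J hJ ↦ (I.proper J hJ).exact_succ j)
        (I.mem (j + 2)) (ih (j + 1) fun m hm ↦ hj m (by lia))
  have h₁ := eventuallyZero_cosyzygyFunctor_of_shortExact S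
    (shortExact_cokernel_desc_cokernel_π I.exact_zero)
    (homToSurjective_cokernel_desc fun J hJ ↦ (I.proper J hJ).exact_zero)
    (I.mem 1) (key n 0 fun m hm ↦ hn m (by lia))
  have := I.mono
  refine eventuallyZero_cosyzygyFunctor_of_shortExact S (f := I.ι) (p := cokernel.π I.ι)
    (w := cokernel.condition _) ?_ (fun J hJ x ↦ (I.proper J hJ).surjective x) (I.mem 0) h₁
  exact ShortComplex.ShortExact.mk' (ShortComplex.exact_cokernel I.ι) I.mono
    (by dsimp; infer_instance)

lemma eventuallyZero_of_relInjDim_lt_top {M : A} (h : relInjDim C M < ⊤) :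
    eventuallyZero (cosyzygyFunctor S) M := by
  obtain ⟨I, hI⟩ := iInf_lt_iff.1 h
  obtain ⟨n, hn⟩ := exists_forall_le_of_iSup_lt_top hI
  exact I.eventuallyZero S fun m hm ↦ not_not.1 (hn m hm)

variable [C.IsStableUnderRetracts]

lemma isZero_iterCosyzygy_trimPreenvelopes {M : A} {k : ℕ}
    (h : IsZero ((endoPow (cosyzygyFunctor S) k).obj ((stableFunctor C).obj M))) {j : ℕ}
    (hj : k < j) : IsZero (iterCosyzygy (trimPreenvelopes S) M j) := by
  have hC (X : A) (hX : IsZero X) : C X :=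
    isZero_stableFunctor_obj_iff.1 ((stableFunctor C).map_isZero hX)
  induction j, hj using Nat.le_induction with
  | base =>
    induction k generalizing M with
    | zero => exact isZero_trimPreenvelopes_cosyz S (isZero_stableFunctor_obj_iff.1 h)
    | succ k ih =>
      rw [← iterCosyzygy_cosyz]
      by_cases hM : C M
      · exact ih (Functor.map_isZero _ ((stableFunctor C).map_isZero
          (isZero_trimPreenvelopes_cosyz S hM)))
      · refine ih ?_
        rw [trimPreenvelopes, dif_neg hM]
        exact h
  | succ j _ ih => exact isZero_trimPreenvelopes_cosyz S (hC _ ih)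

theorem relInjDim_lt_top_iff {M : A} :
    relInjDim C M < ⊤ ↔ eventuallyZero (cosyzygyFunctor S) M := by
  refine ⟨eventuallyZero_of_relInjDim_lt_top S, ?_⟩
  rintro ⟨k, hk⟩
  have hz (j : ℕ) (hj : k + 1 ≤ j) := isZero_iterCosyzygy_trimPreenvelopes S hk hj
  let S' := trimPreenvelopes S
  refine lt_of_le_of_lt (iInf_le _ (spliceCoresolution (C := C) (Z := iterCosyzygy S' M)
    (fun j ↦ (S' (iterCosyzygy S' M j)).ι) (fun j ↦ (S' (iterCosyzygy S' M j)).π)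
    (fun j ↦ (S' (iterCosyzygy S' M j)).ι_π) (fun j ↦ (S' (iterCosyzygy S' M j)).shortExact)
    (fun j ↦ (S' (iterCosyzygy S' M j)).homToSurjective)
    (fun j ↦ (S' (iterCosyzygy S' M j)).mem))) ?_
  refine iSup_lt_top_of_forall_le (n := k + 1) fun j hj h ↦ h ?_
  exact isZero_trimPreenvelopes_I S (hz j hj)
    (isZero_stableFunctor_obj_iff.1 ((stableFunctor C).map_isZero (hz j hj)))

end InjDim

/-! ### Passing to a larger class of objects -/

section Induced

variable {A : Type u} [Category.{v} A] [Abelian A] {P W : ObjectProperty A}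
  [P.IsClosedUnderFiniteProducts] [W.IsClosedUnderFiniteProducts]

/-- The projection from the stable category modulo `P` to that modulo a larger class `W`. -/
def stableProjection (h : P ≤ W) : StableCategory P ⥤ StableCategory W :=
  CategoryTheory.Quotient.lift (stableRel P) (stableFunctor W) fun _ _ f g ⟨X, hX, a, b, hab⟩ ↦
    (stableFunctor_map_eq_iff f g).2 ⟨X, h _ hX, a, b, hab⟩

instance (h : P ≤ W) : (stableProjection h).Additive where
  map_add {M N f g} := by
    obtain ⟨f, rfl⟩ := (stableFunctor P).map_surjective (X := M.as) (Y := N.as) f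
    obtain ⟨g, rfl⟩ := (stableFunctor P).map_surjective (X := M.as) (Y := N.as) g
    rw [← Functor.map_add]
    exact (stableFunctor W).map_add

instance (h : P ≤ W) : (stableProjection h).Full where
  map_surjective {M N} f := by
    obtain ⟨f, rfl⟩ := (stableFunctor W).map_surjective (X := M.as) (Y := N.as) f
    exact ⟨(stableFunctor P).map f, rfl⟩

variable (h : P ≤ W) (F : StableCategory P ⥤ StableCategory P) [F.Additive]
  (hF : ∀ X, W X → W (F.obj ((stableFunctor P).obj X)).as)

/-- The endofunctor of the stable category modulo `W` induced by one modulo `P`. -/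
def inducedFunctor : StableCategory W ⥤ StableCategory W :=
  CategoryTheory.Quotient.lift (stableRel W) (stableFunctor P ⋙ F ⋙ stableProjection h)
    fun M N f g ⟨X, hX, a, b, hab⟩ ↦ by
      let G := stableFunctor P ⋙ F ⋙ stableProjection h
      have : G.Additive := inferInstance
      change G.map f = G.map g
      have hz : IsZero (G.obj X) := isZero_stableFunctor_obj (hF X hX)
      rw [← sub_eq_zero, ← G.map_sub, ← hab, G.map_comp, hz.eq_of_tgt (G.map a) 0, zero_comp]

lemma inducedFunctor_map_stableProjection_map {X Y : StableCategory P} (x : X ⟶ Y) :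
    (inducedFunctor h F hF).map ((stableProjection h).map x) =
      (stableProjection h).map (F.map x) := by
  obtain ⟨x, rfl⟩ := (stableFunctor P).map_surjective (X := X.as) (Y := Y.as) x
  rfl

instance instAdditiveInducedFunctor : (inducedFunctor h F hF).Additive where
  map_add {M N f g} := by
    obtain ⟨f, rfl⟩ := (stableFunctor W).map_surjective (X := M.as) (Y := N.as) f
    obtain ⟨g, rfl⟩ := (stableFunctor W).map_surjective (X := M.as) (Y := N.as) g
    rw [← Functor.map_add]
    exact (stableFunctor P ⋙ F ⋙ stableProjection h).map_add

variable {F}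

omit [F.Additive] in
lemma exists_endoPow_map_eq_zero {k l : ℕ} {X Y : StableCategory P} {x : X ⟶ Y}
    (hx : (endoPow F l).map ((endoPow F k).map x) = 0) : ∃ m, (endoPow F m).map x = 0 := by
  induction k generalizing X Y with
  | zero => exact ⟨l, hx⟩
  | succ k ih =>
    obtain ⟨m, hm⟩ := ih (x := F.map x) hx
    exact ⟨m + 1, hm⟩

lemma stableProjection_map_endoPow_map_eq_zero {k : ℕ} {X Y : StableCategory P} {x : X ⟶ Y}
    (hx : (endoPow (inducedFunctor h F hF) k).map ((stableProjection h).map x) = 0) :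
    (stableProjection h).map ((endoPow F k).map x) = 0 := by
  induction k generalizing X Y with
  | zero => exact hx
  | succ k ih =>
    refine ih (x := F.map x) ?_
    rw [← inducedFunctor_map_stableProjection_map h F hF]
    exact hx

lemma isIso_endoPow_inducedFunctor_map {k : ℕ} {X Y : StableCategory P} {x : X ⟶ Y}
    (hx : IsIso ((endoPow F k).map x)) :
    IsIso ((endoPow (inducedFunctor h F hF) k).map ((stableProjection h).map x)) := by
  induction k generalizing X Y with
  | zero =>
    have : IsIso x := hx
    exact inferInstanceAs (IsIso ((stableProjection h).map x))
  | succ k ih =>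
    have := ih (x := F.map x) hx
    rw [← inducedFunctor_map_stableProjection_map h F hF] at this
    exact this

variable {B : Type u} [Category.{v} B] {L : StableCategory W ⥤ B} {E : B ⥤ B}

/-- A functor extending the induced functor extends the original functor. -/
def projectionCompIso (φ : inducedFunctor h F hF ⋙ L ≅ L ⋙ E) :
    F ⋙ stableProjection h ⋙ L ≅ (stableProjection h ⋙ L) ⋙ E :=
  NatIso.ofComponents (fun X ↦ φ.app ((stableProjection h).obj X)) fun {X Y} x ↦ by
    have := φ.hom.naturality ((stableProjection h).map x)
    dsimp only [Functor.comp_map] at this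
    rw [inducedFunctor_map_stableProjection_map] at this
    exact this

lemma IsRepresentedAfter.projectionCompIso {φ : inducedFunctor h F hF ⋙ L ≅ L ⋙ E} {n : ℕ}
    {X Y : StableCategory P}
    {z : L.obj ((stableProjection h).obj X) ⟶ L.obj ((stableProjection h).obj Y)}
    (hz : IsRepresentedAfter φ n z) :
    IsRepresentedAfter (RelativeCohomology.projectionCompIso h hF φ) n z := by
  induction n generalizing X Y with
  | zero =>
    obtain ⟨x, rfl⟩ := hz
    obtain ⟨x, rfl⟩ := (stableProjection h).map_surjective x
    exact ⟨x, rfl⟩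
  | succ n ih => exact ih (X := F.obj X) (Y := F.obj Y) hz

-- Applying `F` to numerator and denominator moves the fraction one step; after `k` steps the
-- denominator is invertible before `L` is applied.
omit [P.IsClosedUnderFiniteProducts] [F.Additive] in
lemma isRepresentedAfter_of_fraction [P.IsClosedUnderFiniteProducts]
    {L : StableCategory P ⥤ B} {φ : F ⋙ L ≅ L ⋙ E} {k : ℕ} {X Y Y' : StableCategory P}
    {z : L.obj X ⟶ L.obj Y} {f : X ⟶ Y'} {s : Y ⟶ Y'} (hs : IsIso ((endoPow F k).map s))
    (hs' : IsIso (L.map s)) (hz : z ≫ L.map s = L.map f) : IsRepresentedAfter φ k z := by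
  induction k generalizing X Y Y' with
  | zero =>
    have : IsIso s := hs
    exact ⟨f ≫ inv s, by rw [L.map_comp, ← hz, Category.assoc, ← L.map_comp]; simp⟩
  | succ k ih =>
    have h₁ (U V : StableCategory P) (x : U ⟶ V) :
        L.map (F.map x) = φ.hom.app U ≫ E.map (L.map x) ≫ φ.inv.app V := by
      simpa using (NatIso.naturality_2 φ x).symm
    refine ih (f := F.map f) (s := F.map s) hs ?_ ?_
    · rw [h₁]
      have : IsIso (E.map (L.map s)) := inferInstance
      infer_instance
    · rw [h₁, h₁, ← hz]
      simp

variable [Preadditive B] [L.Additive] [E.Additive] [E.Full] [E.Faithful]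

/-- Enlarging `P` to `W` does not affect the stabilized groups, because `hW` says that every object
of `W` is killed by an iterate of `F`. Localizing at morphisms inverted by iterates does not affect
them either. -/
theorem nonempty_stabilizedHom_iso_homBif (hW : W ≤ eventuallyZero F)
    (φ : inducedFunctor h F hF ⋙ L ≅ L ⋙ E)
    (hL : ∀ {X Y : StableCategory W} (f : X ⟶ Y), L.map f = 0 →
      ∃ (Y' : StableCategory W) (s : Y ⟶ Y'), evIso (inducedFunctor h F hF) s ∧ f ≫ s = 0)
    (hL' : ∀ {X Y : StableCategory W} (z : L.obj X ⟶ L.obj Y),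
      ∃ (Y' : StableCategory W) (f : X ⟶ Y') (s : Y ⟶ Y'), evIso (inducedFunctor h F hF) s ∧
        IsIso (L.map s) ∧ z ≫ L.map s = L.map f) (a b : ℕ) :
    Nonempty (stabilizedHom F a b ≅
      homBif (compPow (stableFunctor W ⋙ L) E a) (compPow (stableFunctor W ⋙ L) E b)) := by
  have := isIso_comparison (projectionCompIso h hF φ) ?_ ?_ a b
  · exact ⟨@asIso _ _ _ _ _ this⟩
  · intro X Y x hx
    -- After `k` iterations `s` can be cancelled, so the morphism vanishes modulo `W`, that is,
    -- factors through some `Z` in `W`; the `l` iterates that kill `Z` then kill it modulo `P`.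
    obtain ⟨Y', s, ⟨k, hs⟩, hxs⟩ := hL _ hx
    have h₁ : (endoPow (inducedFunctor h F hF) k).map ((stableProjection h).map x) = 0 := by
      rw [← cancel_mono ((endoPow (inducedFunctor h F hF) k).map s), ← Functor.map_comp, hxs,
        Functor.map_zero, zero_comp]
    have h₂ := stableProjection_map_endoPow_map_eq_zero h hF h₁
    obtain ⟨g, hg⟩ := (stableFunctor P).map_surjective (X := ((endoPow F k).obj X).as)
      (Y := ((endoPow F k).obj Y).as) ((endoPow F k).map x)
    rw [← hg] at h₂
    obtain ⟨Z, hZ, u, v, rfl⟩ := (stableFunctor_map_eq_zero_iff (P := W) g).1 h₂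
    obtain ⟨l, hl⟩ := hW _ hZ
    refine exists_endoPow_map_eq_zero (k := k) (l := l) ?_
    rw [← hg, Functor.map_comp, Functor.map_comp, hl.eq_of_tgt ((endoPow F l).map _) 0, zero_comp]
  · intro X Y z
    obtain ⟨Y', f, s, ⟨k, hs⟩, hs', hz⟩ := hL' z
    exact ⟨k, (isRepresentedAfter_of_fraction hs hs' hz).projectionCompIso⟩

end Induced

/-! ### The common quotient of the two stable categories -/

section Balance

variable {A : Type u} [Category.{v} A] [Abelian A] [HasExt.{w} A] {C D : ObjectProperty A}
  [C.IsClosedUnderFiniteProducts] [D.IsClosedUnderFiniteProducts]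
  (S : SpecialPreenvelopes.{w} C) (T : SpecialPrecovers.{w} D)

/-- The objects with some vanishing iterated cosyzygy and some vanishing iterated syzygy. -/
def biFinite : ObjectProperty A :=
  eventuallyZero (cosyzygyFunctor S) ⊓ eventuallyZero (syzygyFunctor T)

instance : (biFinite S T).IsClosedUnderFiniteProducts where
  isClosedUnderLimitsOfShape J _ :=
    { limitsOfShape_le := by
        rintro X ⟨p⟩
        exact ⟨ObjectProperty.prop_of_isLimit _ p.isLimit fun j ↦ (p.prop_diag_obj j).1,
          ObjectProperty.prop_of_isLimit _ p.isLimit fun j ↦ (p.prop_diag_obj j).2⟩ }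

variable {S T}

/-- Only the vanishing of the syzygies of `ΣX` is in question. The counit `ΩΣX ⟶ X` becomes
invertible under an iterate of `Ω`, because the envelope of `X`, being in `C`, is killed by one. -/
lemma biFinite.cosyz (hDC : IsBalancedPair D C) (hC : C ≤ biFinite S T) {X : A}
    (hX : biFinite S T X) : biFinite S T (S X).cosyz := by
  obtain ⟨⟨k, hk⟩, ⟨l, hl⟩⟩ := hX
  obtain ⟨ε, hε⟩ := hDC.exists_isCounitMap (S X) (T (S X).cosyz)
  obtain ⟨m, hm⟩ := (hC _ (S X).mem).2
  have := isIso_endoPow_map_of_le (le_max_left m l) (hε.isIso_endoPow_map T hm)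
  exact ⟨⟨k, isZero_endoPow_obj_of_le k.le_succ hk⟩, max m l + 1,
    (isZero_endoPow_obj_of_le (le_max_right m l) hl).of_iso
      (@asIso _ _ _ _ _ this)⟩

/-- Dually, the unit `X ⟶ ΣΩX` controls the cosyzygies of `ΩX`. -/
lemma biFinite.syz (hDC : IsBalancedPair D C) (hD : D ≤ biFinite S T) {X : A}
    (hX : biFinite S T X) : biFinite S T (T X).syz := by
  obtain ⟨⟨k, hk⟩, ⟨l, hl⟩⟩ := hX
  obtain ⟨η, hη⟩ := hDC.exists_isUnitMap (T X) (S (T X).syz)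
  obtain ⟨m, hm⟩ := (hD _ (T X).mem).1
  have := isIso_endoPow_map_of_le (le_max_left m k) (hη.isIso_endoPow_map S hm)
  exact ⟨⟨max m k + 1, (isZero_endoPow_obj_of_le (le_max_right m k) hk).of_iso
      (@asIso _ _ _ _ _ this).symm⟩,
    l, isZero_endoPow_obj_of_le l.le_succ hl⟩

variable (hDC : IsBalancedPair D C) (hC : C ≤ biFinite S T) (hD : D ≤ biFinite S T)

/-- The cosyzygy endofunctor of the common quotient. -/
abbrev biCosyzygyFunctor : StableCategory (biFinite S T) ⥤ StableCategory (biFinite S T) :=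
  inducedFunctor hC (cosyzygyFunctor S) fun _ hX ↦ hX.cosyz hDC hC

instance : (biCosyzygyFunctor hDC hC).Additive :=
  instAdditiveInducedFunctor hC (cosyzygyFunctor S) fun _ hX ↦ hX.cosyz hDC hC

/-- The syzygy endofunctor of the common quotient. -/
abbrev biSyzygyFunctor : StableCategory (biFinite S T) ⥤ StableCategory (biFinite S T) :=
  inducedFunctor hD (syzygyFunctor T) fun _ hX ↦ hX.syz hDC hD

instance : (biSyzygyFunctor hDC hD).Additive :=
  instAdditiveInducedFunctor hD (syzygyFunctor T) fun _ hX ↦ hX.syz hDC hD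

lemma IsCosyzygyMap.biCosyzygyFunctor_map {M N : A} {f : M ⟶ N}
    {b : (S M).cosyz ⟶ (S N).cosyz} (hb : IsCosyzygyMap (S M) (S N) f b) :
    (biCosyzygyFunctor hDC hC).map ((stableFunctor (biFinite S T)).map f) =
      (stableFunctor (biFinite S T)).map b :=
  congrArg (fun x ↦ (stableProjection hC).map x) hb.cosyzygyFunctor_map

lemma IsSyzygyMap.biSyzygyFunctor_map {M N : A} {f : M ⟶ N}
    {b : (T M).syz ⟶ (T N).syz} (hb : IsSyzygyMap (T M) (T N) f b) :
    (biSyzygyFunctor hDC hD).map ((stableFunctor (biFinite S T)).map f) =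
      (stableFunctor (biFinite S T)).map b :=
  congrArg (fun x ↦ (stableProjection hD).map x) hb.syzygyFunctor_map

/-- The unit `M ⟶ ΣΩM`. -/
def syzygyUnit : 𝟭 (StableCategory (biFinite S T)) ⟶
    biSyzygyFunctor hDC hD ⋙ biCosyzygyFunctor hDC hC :=
  CategoryTheory.Quotient.natTransLift (stableRel (biFinite S T))
    { app := fun M ↦ (stableFunctor (biFinite S T)).map
        (hDC.exists_isUnitMap (T M) (S (T M).syz)).choose
      naturality := fun M N f ↦ by
        obtain ⟨b, hb⟩ := exists_isSyzygyMap (T M) (T N) f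
        obtain ⟨c, hc⟩ := exists_isCosyzygyMap (S (T M).syz) (S (T N).syz) b
        have h : (biCosyzygyFunctor hDC hC).map ((biSyzygyFunctor hDC hD).map
            ((stableFunctor (biFinite S T)).map f)) = (stableFunctor (biFinite S T)).map c := by
          rw [hb.biSyzygyFunctor_map hDC hD]
          exact hc.biCosyzygyFunctor_map hDC hC
        -- The naturality defect factors through an object of `C`, which is zero in the common
        -- quotient.
        have h' := (stableFunctor_map_eq_iff (P := biFinite S T) _ _).2
          (((hDC.exists_isUnitMap (T M) (S (T M).syz)).choose_spec.factorsThrough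
            (hDC.exists_isUnitMap (T N) (S (T N).syz)).choose_spec hb hc).imp
            fun X ⟨hX, hX'⟩ ↦ ⟨hC X hX, hX'⟩)
        rw [Functor.map_comp, Functor.map_comp, ← h] at h'
        exact h' }

/-- The counit `ΩΣN ⟶ N`. -/
def cosyzygyCounit : biCosyzygyFunctor hDC hC ⋙ biSyzygyFunctor hDC hD ⟶
    𝟭 (StableCategory (biFinite S T)) :=
  CategoryTheory.Quotient.natTransLift (stableRel (biFinite S T))
    { app := fun N ↦ (stableFunctor (biFinite S T)).map
        (hDC.exists_isCounitMap (S N) (T (S N).cosyz)).choose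
      naturality := fun M N f ↦ by
        obtain ⟨c, hc⟩ := exists_isCosyzygyMap (S M) (S N) f
        obtain ⟨b, hb⟩ := exists_isSyzygyMap (T (S M).cosyz) (T (S N).cosyz) c
        have h : (biSyzygyFunctor hDC hD).map ((biCosyzygyFunctor hDC hC).map
            ((stableFunctor (biFinite S T)).map f)) = (stableFunctor (biFinite S T)).map b := by
          rw [hc.biCosyzygyFunctor_map hDC hC]
          exact hb.biSyzygyFunctor_map hDC hD
        have h' := (stableFunctor_map_eq_iff (P := biFinite S T) _ _).2
          (((hDC.exists_isCounitMap (S M) (T (S M).cosyz)).choose_spec.factorsThrough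
            (hDC.exists_isCounitMap (S N) (T (S N).cosyz)).choose_spec hc hb).imp
            fun X ⟨hX, hX'⟩ ↦ ⟨hD X hX, hX'⟩)
        rw [Functor.map_comp, Functor.map_comp, ← h] at h'
        exact h' }

/-- The precover of `X` is in `D` and hence killed by an iterate of `Σ`; that iterate inverts the
unit modulo `C`, and so modulo the larger class. -/
lemma evIso_syzygyUnit_app (X : StableCategory (biFinite S T)) :
    evIso (biCosyzygyFunctor hDC hC) ((syzygyUnit hDC hC hD).app X) := by
  obtain ⟨m, hm⟩ := (hD _ (T X.as).mem).1
  exact ⟨m, isIso_endoPow_inducedFunctor_map hC _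
    ((hDC.exists_isUnitMap (T X.as) (S (T X.as).syz)).choose_spec.isIso_endoPow_map S hm)⟩

lemma evIso_cosyzygyCounit_app (X : StableCategory (biFinite S T)) :
    evIso (biSyzygyFunctor hDC hD) ((cosyzygyCounit hDC hC hD).app X) := by
  obtain ⟨m, hm⟩ := (hC _ (S X.as).mem).2
  exact ⟨m, isIso_endoPow_inducedFunctor_map hD _
    ((hDC.exists_isCounitMap (S X.as) (T (S X.as).cosyz)).choose_spec.isIso_endoPow_map T hm)⟩

-- Both sides are Hom-bifunctors of the same localization, where `Ω` acts as the inverse of `Σ`.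
include hDC hC hD in
theorem nonempty_completeExtC_iso_completeExtD (n : ℤ) :
    Nonempty (completeExtC S n ≅ completeExtD T n) := by
  obtain ⟨K⟩ := nonempty_mutualInversion (syzygyUnit hDC hC hD) (cosyzygyCounit hDC hC hD)
    (evIso_syzygyUnit_app hDC hC hD) (evIso_cosyzygyCounit_app hDC hC hD)
  obtain ⟨i⟩ := nonempty_stabilizedHom_iso_homBif hC _ inf_le_left K.functorIso
    (fun f hf ↦ by
      obtain ⟨Y', s, hs, -, h⟩ := K.exists_comp_eq_zero f hf
      exact ⟨Y', s, hs, h⟩)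
    (fun z ↦ by
      obtain ⟨Y', f, s, hs, hs', h⟩ := K.exists_fraction z
      exact ⟨Y', f, s, hs, K.isIso_map s hs hs', h⟩) (-n).toNat n.toNat
  obtain ⟨j⟩ := nonempty_stabilizedHom_iso_homBif hD _ inf_le_right K.inverseIso
    (fun f hf ↦ by
      obtain ⟨Y', s, -, hs, h⟩ := K.exists_comp_eq_zero f hf
      exact ⟨Y', s, hs, h⟩)
    (fun z ↦ by
      obtain ⟨Y', f, s, hs, hs', h⟩ := K.exists_fraction z
      exact ⟨Y', f, s, hs', K.isIso_map s hs hs', h⟩) n.toNat (-n).toNat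
  -- One of the exponents `(-n).toNat` and `n.toNat` is always zero.
  obtain ⟨l⟩ := nonempty_homBif_compPow_iso_inverse K.equivalence
    (stableFunctor (biFinite S T) ⋙ K.functor) (a := (-n).toNat) (b := n.toNat) (by lia)
  exact ⟨i ≪≫ l ≪≫ j.symm⟩

end Balance

/-! ### Vanishing of the identity in complete cohomology -/

section Vanishing

variable {A : Type u} [Category.{v} A] [Abelian A] {P : ObjectProperty A}
  [P.IsClosedUnderFiniteProducts] {F : StableCategory P ⥤ StableCategory P} [F.Additive]

lemma subsingleton_stabilizedHom {M : A} (hM : P M) :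
    Subsingleton (((stabilizedHom F 0 0).obj (op M)).obj M) := by
  refine subsingleton_of_forall_eq 0 fun y ↦ ?_
  obtain ⟨k, x, rfl⟩ := exists_stabilizedHomMk_eq F 0 0 M M y
  have h (k : ℕ) : IsZero ((iterFunctor F k).obj M) := by
    induction k with
    | zero => exact isZero_stableFunctor_obj hM
    | succ k ih => exact F.map_isZero ih
  rw [(h (0 + k)).eq_of_src x 0, map_zero]

/-- The class of the identity at stage zero vanishes, so an iterate of `F` sends the identity of `M`
to zero. -/
lemma eventuallyZero_of_subsingleton_stabilizedHom {M : A}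
    (hM : Subsingleton (((stabilizedHom F 0 0).obj (op M)).obj M)) : eventuallyZero F M := by
  obtain ⟨l, hl⟩ := exists_endoPow_map_eq_zero_of_stabilizedHomMk_eq_zero F 0 0 M M 0
    (𝟙 ((stableFunctor P).obj M)) (Subsingleton.elim _ _)
  refine ⟨l, (IsZero.iff_id_eq_zero _).2 ?_⟩
  rw [← CategoryTheory.Functor.map_id]
  exact hl

lemma subsingleton_of_iso {G H : AddCommGrpCat.{v}} (e : G ≅ H) [Subsingleton G] :
    Subsingleton H :=
  e.addCommGroupIsoToAddEquiv.symm.toEquiv.subsingleton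

end Vanishing

end RelativeCohomology

end

/-! ### The equivalence of the three conditions. -/

theorem theorem5p9 {A : Type u} [Category.{v} A] [Abelian A] [IsGrothendieckAbelian.{w} A]
    [EnoughProjectives A] (C D : ObjectProperty A)
    [C.IsClosedUnderFiniteProducts] [C.IsStableUnderRetracts]
    [D.IsClosedUnderFiniteProducts] [D.IsStableUnderRetracts]
    (S : RelativeCohomology.SpecialPreenvelopes.{w} C)
    (T : RelativeCohomology.SpecialPrecovers.{w} D)
    (hDC : RelativeCohomology.IsBalancedPair D C)
    (hD : RelativeCohomology.IsResolving D) (hC : RelativeCohomology.IsCoresolving C) :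
    List.TFAE [
      (∀ X : A, C X → RelativeCohomology.relProjDim D X < ⊤) ∧
        (∀ X : A, D X → RelativeCohomology.relInjDim C X < ⊤),
      ∀ n : ℤ, Nonempty
        (RelativeCohomology.completeExtC S n ≅ RelativeCohomology.completeExtD T n),
      ∀ M : A, C M ∨ D M → Nonempty
        (((RelativeCohomology.completeExtC S 0).obj (op M)).obj M ≅
          ((RelativeCohomology.completeExtD T 0).obj (op M)).obj M)] := by
  tfae_have 1 → 2 := fun ⟨h₁, h₂⟩ n ↦
    RelativeCohomology.nonempty_completeExtC_iso_completeExtD hDC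
      (fun X hX ↦ ⟨RelativeCohomology.eventuallyZero_of_mem hX,
        (RelativeCohomology.relProjDim_lt_top_iff T).1 (h₁ X hX)⟩)
      (fun X hX ↦ ⟨(RelativeCohomology.relInjDim_lt_top_iff S).1 (h₂ X hX),
        RelativeCohomology.eventuallyZero_of_mem hX⟩) n
  tfae_have 2 → 3 := fun h M _ ↦ (h 0).map fun e ↦ (e.app (op M)).app M
  tfae_have 3 → 1 := by
    intro h
    refine ⟨fun X hX ↦ (RelativeCohomology.relProjDim_lt_top_iff T).2 ?_,
      fun X hX ↦ (RelativeCohomology.relInjDim_lt_top_iff S).2 ?_⟩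
    · obtain ⟨e⟩ := h X (Or.inl hX)
      have : Subsingleton (((RelativeCohomology.completeExtC S 0).obj (op X)).obj X) :=
        RelativeCohomology.subsingleton_stabilizedHom hX
      exact RelativeCohomology.eventuallyZero_of_subsingleton_stabilizedHom
        (RelativeCohomology.subsingleton_of_iso e)
    · obtain ⟨e⟩ := h X (Or.inr hX)
      have : Subsingleton (((RelativeCohomology.completeExtD T 0).obj (op X)).obj X) :=
        RelativeCohomology.subsingleton_stabilizedHom hX
      exact RelativeCohomology.eventuallyZero_of_subsingleton_stabilizedHom
        (RelativeCohomology.subsingleton_of_iso e.symm)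
  tfae_finish
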